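/- Let $n,p\ge 1$ be integers. For a tensor $\mathscr A=[a_{ijk}]\in\mathbb C^{m\times n\times p}$ let $\operatorname{bcirc}(\mathscr A)\in\mathbb C^{mp\times np}$ be the block-circulant matrix whose $(k,l)$ block is the frontal slice of $\mathscr A$ with index $k-l+1$ modulo $p$, and let $\operatorname{unfold}(\mathscr A)\in\mathbb C^{mp\times n}$ be the stack of the frontal slices, with inverse $\operatorname{fold}$. The T-product is $\mathscr A*\mathscr B=\operatorname{fold}(\operatorname{bcirc}(\mathscr A)\operatorname{unfold}(\mathscr B))$, and $\langle \mathscr X,\mathscr Y\rangle_F=\sum_{i,j,k}\overline{x_{ijk}}\,y_{ijk}$. Inverses of tensors in $\mathbb C^{n\times n\times p}$ are two-sided inverses for $*$ with respect to the identity tensor $\mathscr I$, for which $\operatorname{bcirc}(\mathscr I)=I_{np}$. Let $$\mathbb T_+^{n\times n\times p}=\{\mathscr A\in\mathbb C^{n\times n\times p} : \operatorname{Re}\langle \mathscr X,\mathscr A*\mathscr X\rangle_F>0\ \text{for all nonzero } \mathscr X\in\mathbb C^{n\times 1\times p}\}.$$ For $\mathscr A\in\mathbb T_+^{n\times n\times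 p}$ the canonical T-phase vector is the unique vector $\phi(\mathscr A)=(\phi_1,\dots,\phi_{np})$ with $\pi\ge\phi_1\ge\cdots\ge\phi_{np}>-\pi$ and $\phi_1-\phi_{np}<\pi$ such that $\operatorname{bcirc}(\mathscr A)=T^HDT$ for some nonsingular $T$ and some diagonal unitary $D$ whose diagonal entries are, in some order, $e^{i\phi_1},\dots,e^{i\phi_{np}}$. A symmetric gauge function is a norm $\Psi:\mathbb R^{np}\to\mathbb R$ that is invariant under permutations and sign changes of the coordinates; the associated T-phase gauge is $\measuredangle_\Psi\mathscr A=\Psi(\phi(\mathscr A))$. **Corollary.** Let $\mathscr A,\mathscr B\in\mathbb T_+^{n\times n\times p}$, and let the geometric mean $\mathscr A\#\mathscr B$ be defined by $$(\mathscr A\#\mathscr B)^{-1}=\frac2\pi\int_0^\infty\bigl(t\mathscr A+t^{-1}\mathscr B\bigr)^{-1}\,\frac{dt}{t}.$$ This is well defined: $t\mathscr A+t^{-1}\mathscr B$ is T-invertible for every $t>0$, the integral converges absolutely, its value is T-invertible, and $\mathscr A\#\mathscr B\in\mathbb T_+^{n\times n\times p}$. For every symmetric gauge function $\Psi:\mathbb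 R^{np}\to\mathbb R$, $$\measuredangle_\Psi(\mathscr A\#\mathscr B)\le\tfrac12\measuredangle_\Psi\mathscr A+\tfrac12\measuredangle_\Psi\mathscr B .$$ -/

import Mathlib

open scoped Matrix ComplexConjugate

noncomputable section

/-- Third-order complex tensors `A = [a_{ijk}]` of size `m × n × p`; the third index is read
modulo `p`, and `A · · k` is the `k`-th frontal slice. -/
abbrev Tensor3 (m n p : ℕ) : Type := Fin m → Fin n → Fin p → ℂ

namespace Tensor3

variable {m n s p : ℕ}

/-- The block-circulant matrix whose `(k, l)` block is the frontal slice of index `k - l` mod `p`,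
so that its first block column is the stack of the frontal slices. -/
def bcirc (A : Tensor3 m n p) : Matrix (Fin p × Fin m) (Fin p × Fin n) ℂ :=
  Matrix.of fun x y => A x.2 y.2 (x.1 - y.1)

/-- The stack of the frontal slices. -/
def unfold (A : Tensor3 m n p) : Matrix (Fin p × Fin m) (Fin n) ℂ :=
  Matrix.of fun x j => A x.2 j x.1

/-- The inverse of `unfold`. -/
def fold (M : Matrix (Fin p × Fin m) (Fin n) ℂ) : Tensor3 m n p :=
  fun i j k => M (k, i) j

/-- The T-product. -/
def tProd (A : Tensor3 m n p) (B : Tensor3 n s p) : Tensor3 m s p :=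
  fold (bcirc A * unfold B)

/-- The identity tensor: its first frontal slice is the identity, the others vanish. -/
def tOne (n p : ℕ) [NeZero p] : Tensor3 n n p :=
  fun i j k => if i = j ∧ k = 0 then 1 else 0

/-- The Frobenius inner product, conjugate-linear in the first argument. -/
def frobInner (A B : Tensor3 m n p) : ℂ :=
  ∑ i, ∑ j, ∑ k, conj (A i j k) * B i j k

/-- `X` is a (two-sided) T-inverse of `A`. -/
def IsTInverse [NeZero p] (A X : Tensor3 n n p) : Prop :=
  tProd A X = tOne n p ∧ tProd X A = tOne n p

open Classical in
/-- The T-inverse of a T-invertible tensor (and `0` for a tensor which is not T-invertible). -/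
def tInv [NeZero p] (A : Tensor3 n n p) : Tensor3 n n p :=
  if h : ∃ X, IsTInverse A X then h.choose else 0

/-- The class `𝕋₊` of strictly accretive tensors: `Re ⟨X, A * X⟩_F > 0` for all nonzero
`X ∈ ℂ^{n × 1 × p}`. -/
def TPlus (n p : ℕ) : Set (Tensor3 n n p) :=
  {A | ∀ X : Tensor3 n 1 p, X ≠ 0 → 0 < (frobInner X (tProd A X)).re}

/-- The integrand `(t A + t⁻¹ B)⁻¹ / t`. -/
def geomMeanIntegrand [NeZero p] (A B : Tensor3 n n p) (t : ℝ) : Tensor3 n n p :=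
  t⁻¹ • tInv (t • A + t⁻¹ • B)

/-- `(2 / π) ∫₀^∞ (t A + t⁻¹ B)⁻¹ dt / t`. -/
def geomMeanIntegral [NeZero p] (A B : Tensor3 n n p) : Tensor3 n n p :=
  (2 / Real.pi) • ∫ t in Set.Ioi (0 : ℝ), geomMeanIntegrand A B t

/-- The geometric mean `A # B`, whose T-inverse is `geomMeanIntegral A B`. -/
def geomMean [NeZero p] (A B : Tensor3 n n p) : Tensor3 n n p :=
  tInv (geomMeanIntegral A B)

/-- `φ` is the canonical T-phase vector of `A`: there is a sectorial decomposition
`bcirc A = Tᴴ D T` with `T` nonsingular and `D` diagonal unitary such that `φ` lists the arguments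
in `(-π, π]` of the diagonal entries of `D` (matched through `e`) in decreasing order, and the
phases spread over less than `π`. Such an `A` is automatically sectorial. -/
def IsPhaseVector (A : Tensor3 n n p) (φ : Fin (n * p) → ℝ) : Prop :=
  Antitone φ ∧ (∀ k, φ k ∈ Set.Ioc (-Real.pi) Real.pi) ∧ (∀ k l, φ k - φ l < Real.pi) ∧
    ∃ (T : Matrix (Fin p × Fin n) (Fin p × Fin n) ℂ) (e : Fin p × Fin n ≃ Fin (n * p)),
      IsUnit T ∧
        bcirc A = Tᴴ * Matrix.diagonal (fun x => Complex.exp (Complex.I * φ (e x))) * T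

open Classical in
/-- The canonical T-phase vector `φ(A)`. For `A ∈ 𝕋₊` it exists and is unique, see
`existsUnique_isPhaseVector`; where there is none the value is `0`. -/
def tPhase (A : Tensor3 n n p) : Fin (n * p) → ℝ :=
  if h : ∃ φ, IsPhaseVector A φ then h.choose else 0

/-- The T-phase gauge of `A` associated with `Ψ`. -/
def phaseGauge (Ψ : (Fin (n * p) → ℝ) → ℝ) (A : Tensor3 n n p) : ℝ :=
  Ψ (tPhase A)

end Tensor3

/-- A symmetric gauge function: a norm invariant under signed permutations of the coordinates. -/
structure IsSymmetricGauge {ι : Type*} (Ψ : (ι → ℝ) → ℝ) : Prop where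
  nonneg : ∀ x, 0 ≤ Ψ x
  eq_zero_iff : ∀ x, Ψ x = 0 ↔ x = 0
  smul : ∀ (c : ℝ) (x : ι → ℝ), Ψ (c • x) = |c| * Ψ x
  add_le : ∀ x y, Ψ (x + y) ≤ Ψ x + Ψ y
  perm : ∀ (σ : Equiv.Perm ι) (x : ι → ℝ), Ψ (x ∘ σ) = Ψ x
  sign : ∀ (ε : ι → ℝ), (∀ i, ε i = 1 ∨ ε i = -1) → ∀ x, Ψ (ε * x) = Ψ x

namespace Tensor3

variable {n p : ℕ}

/-- The Frobenius form of `A` is the quadratic form of `bcirc A`. -/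
theorem frobInner_tProd_eq (A : Tensor3 n n p) (v : Fin p × Fin n → ℂ) :
    frobInner (m := n) (n := 1) (fun i _ k => v (k, i)) (tProd A (fun i _ k => v (k, i)))
      = star v ⬝ᵥ (bcirc A *ᵥ v) := by
  simp only [frobInner, tProd, fold, unfold, Matrix.mul_apply, Matrix.of_apply, dotProduct,
    Matrix.mulVec, Fintype.sum_prod_type, Pi.star_apply, Finset.univ_unique, Finset.sum_singleton]
  exact Finset.sum_comm

theorem bcirc_pos {A : Tensor3 n n p} (hA : A ∈ TPlus n p) (v : Fin p × Fin n → ℂ) (hv : v ≠ 0) :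
    0 < (star v ⬝ᵥ (bcirc A *ᵥ v)).re := by
  rw [← frobInner_tProd_eq]
  refine hA _ fun h => hv ?_
  ext x
  exact congrFun (congrFun (congrFun h x.2) 0) x.1

theorem herm_diag {I : Type*} [Fintype I] [DecidableEq I] (N : Matrix I I ℂ)
    (hN : N.IsHermitian) : ∃ (U : Matrix I I ℂ), Uᴴ * U = 1 ∧
      Uᴴ * N * U = Matrix.diagonal (fun i => (hN.eigenvalues i : ℂ)) := by
  refine ⟨hN.eigenvectorUnitary, ?_, ?_⟩
  · exact Unitary.coe_star_mul_self _
  · have := hN.conjStarAlgAut_star_eigenvectorUnitary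
    rw [Unitary.conjStarAlgAut_star_apply] at this
    exact this

open scoped ComplexOrder in
theorem exists_diagonalization {I : Type*} [Fintype I] [DecidableEq I] (M : Matrix I I ℂ)
    (hM : ∀ v, v ≠ 0 → 0 < (star v ⬝ᵥ (M *ᵥ v)).re) :
    ∃ (T : Matrix I I ℂ) (θ : I → ℝ), IsUnit T ∧
      (∀ i, θ i ∈ Set.Ioo (-(Real.pi / 2)) (Real.pi / 2)) ∧
      M = Tᴴ * Matrix.diagonal (fun i => Complex.exp (Complex.I * θ i)) * T := by
  have hconj : ∀ v, star v ⬝ᵥ (Mᴴ *ᵥ v) = conj (star v ⬝ᵥ (M *ᵥ v)) := by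
    intro v
    rw [starRingEnd_apply, ← Matrix.star_dotProduct_star, star_star, Matrix.star_mulVec,
      ← Matrix.dotProduct_mulVec]
  set H : Matrix I I ℂ := M + Mᴴ with hH
  have hHh : H.IsHermitian := by
    simp [Matrix.IsHermitian, hH, add_comm]
  have hHp : H.PosDef := by
    refine Matrix.PosDef.of_dotProduct_mulVec_pos hHh fun x hx => ?_
    rw [hH, Matrix.add_mulVec, dotProduct_add, hconj, Complex.add_conj]
    have := hM x hx
    exact_mod_cast (by positivity : 0 < 2 * (star x ⬝ᵥ (M *ᵥ x)).re)
  have hev := hHp.eigenvalues_pos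
  obtain ⟨U, hU, hUH⟩ := herm_diag H hHh
  let d : I → ℂ := fun i => ((Real.sqrt (2 / hHh.eigenvalues i) : ℝ) : ℂ)
  let P := U * Matrix.diagonal d
  have hPH : Pᴴ * H * P = (2 : ℂ) • 1 := by
    have : Pᴴ * H * P = (Matrix.diagonal d)ᴴ * (Uᴴ * H * U) * Matrix.diagonal d := by
      simp only [P, Matrix.conjTranspose_mul, Matrix.mul_assoc]
    rw [this, hUH, Matrix.diagonal_conjTranspose, Matrix.diagonal_mul_diagonal,
      Matrix.diagonal_mul_diagonal, ← Matrix.diagonal_one, ← Matrix.diagonal_smul]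
    congr 1
    ext i
    have h0 := hev i
    have : Real.sqrt (2 / hHh.eigenvalues i) * hHh.eigenvalues i *
        Real.sqrt (2 / hHh.eigenvalues i) = 2 := by
      rw [mul_right_comm, Real.mul_self_sqrt (by positivity)]
      field_simp
    simpa [d] using congrArg (fun r : ℝ => (r : ℂ)) this
  let K := Complex.I • (Mᴴ - M)
  have hK : K.IsHermitian := by
    simp only [K, Matrix.IsHermitian, Matrix.conjTranspose_smul, Matrix.conjTranspose_sub,
      Matrix.conjTranspose_conjTranspose, RCLike.star_def, Complex.conj_I, neg_smul, ← smul_neg,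
      neg_sub]
  have hK' : (Pᴴ * K * P).IsHermitian := Matrix.isHermitian_conjTranspose_mul_mul P hK
  obtain ⟨V, hV, hVK⟩ := herm_diag _ hK'
  let Q := P * V
  have hQ1 : Qᴴ * H * Q = (2 : ℂ) • 1 := by
    have : Qᴴ * H * Q = Vᴴ * (Pᴴ * H * P) * V := by
      simp only [Q, Matrix.conjTranspose_mul, Matrix.mul_assoc]
    rw [this, hPH, Matrix.mul_smul, Matrix.smul_mul, Matrix.mul_one, hV]
  have hQ2 : Qᴴ * K * Q = Matrix.diagonal (fun i => (hK'.eigenvalues i : ℂ)) := by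
    rw [← hVK]
    simp only [Q, Matrix.conjTranspose_mul, Matrix.mul_assoc]
  have hMHK : (2 : ℂ) • M = H + Complex.I • K := by
    simp only [K, hH, smul_smul, Complex.I_mul_I, neg_smul, one_smul, two_smul]
    abel
  let μ : I → ℝ := fun i => hK'.eigenvalues i / 2
  have hQM : Qᴴ * M * Q = Matrix.diagonal (fun i => 1 + Complex.I * (μ i : ℂ)) := by
    have h2 : (2 : ℂ) • (Qᴴ * M * Q) =
        (2 : ℂ) • Matrix.diagonal (fun i => 1 + Complex.I * (μ i : ℂ)) := by
      rw [← Matrix.smul_mul, ← Matrix.mul_smul, hMHK, Matrix.mul_add, Matrix.add_mul, hQ1,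
        Matrix.mul_smul, Matrix.smul_mul, hQ2, ← Matrix.diagonal_one, ← Matrix.diagonal_smul,
        ← Matrix.diagonal_smul, ← Matrix.diagonal_smul, Matrix.diagonal_add]
      congr 1
      ext i
      simp [μ]
      ring
    exact smul_right_injective _ (two_ne_zero) h2
  have hdetQ : IsUnit Q.det := by
    rw [isUnit_iff_ne_zero]
    intro h0
    have hh := congrArg Matrix.det hQ1
    rw [Matrix.det_mul, h0, mul_zero, Matrix.det_smul, Matrix.det_one, mul_one] at hh
    exact pow_ne_zero _ two_ne_zero hh.symm
  let r : I → ℝ := fun i => Real.sqrt (Real.sqrt (1 + μ i ^ 2))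
  have hr : ∀ i, 0 < r i := fun i => by positivity
  refine ⟨Matrix.diagonal (fun i => (r i : ℂ)) * Q⁻¹, fun i => Real.arctan (μ i), ?_,
    fun i => ⟨Real.neg_pi_div_two_lt_arctan _, Real.arctan_lt_pi_div_two _⟩, ?_⟩
  · rw [Matrix.isUnit_iff_isUnit_det, Matrix.det_mul, Matrix.det_diagonal]
    refine IsUnit.mul ?_ ?_
    · rw [isUnit_iff_ne_zero, Finset.prod_ne_zero_iff]
      intro i _
      exact_mod_cast (hr i).ne'
    · exact Matrix.isUnit_nonsing_inv_det _ hdetQ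
  · have h1 : Matrix.diagonal (fun i => 1 + Complex.I * (μ i : ℂ)) =
        (Matrix.diagonal (fun i => (r i : ℂ)))ᴴ *
          Matrix.diagonal (fun i => Complex.exp (Complex.I * (Real.arctan (μ i) : ℝ))) *
          Matrix.diagonal (fun i => (r i : ℂ)) := by
      rw [Matrix.diagonal_conjTranspose, Matrix.diagonal_mul_diagonal,
        Matrix.diagonal_mul_diagonal]
      congr 1
      ext i
      have hs : 0 < Real.sqrt (1 + μ i ^ 2) := by positivity
      have hrr : r i * r i = Real.sqrt (1 + μ i ^ 2) := Real.mul_self_sqrt hs.le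
      have hc : Complex.exp (Complex.I * (Real.arctan (μ i) : ℝ)) =
          ((Real.sqrt (1 + μ i ^ 2))⁻¹ : ℝ) * (1 + Complex.I * (μ i : ℂ)) := by
        rw [mul_comm Complex.I, Complex.exp_mul_I, ← Complex.ofReal_cos, ← Complex.ofReal_sin,
          Real.cos_arctan, Real.sin_arctan]
        push_cast
        ring
      have hne : ((Real.sqrt (1 + μ i ^ 2) : ℝ) : ℂ) ≠ 0 := by exact_mod_cast hs.ne'
      have hrc : (r i : ℂ) * (r i : ℂ) = ((Real.sqrt (1 + μ i ^ 2) : ℝ) : ℂ) := by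
        exact_mod_cast hrr
      rw [hc]
      simp only [Pi.star_apply, RCLike.star_def, Complex.conj_ofReal]
      rw [mul_right_comm, hrc, Complex.ofReal_inv, ← mul_assoc, mul_inv_cancel₀ hne, one_mul]
    rw [Matrix.conjTranspose_mul]
    have h2 : M = (Q⁻¹)ᴴ * (Qᴴ * M * Q) * Q⁻¹ := by
      have : (Q⁻¹)ᴴ * Qᴴ = 1 := by
        rw [← Matrix.conjTranspose_mul, Matrix.mul_nonsing_inv _ hdetQ, Matrix.conjTranspose_one]
      calc M = ((Q⁻¹)ᴴ * Qᴴ) * M * (Q * Q⁻¹) := by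
            rw [this, Matrix.mul_nonsing_inv _ hdetQ, Matrix.one_mul, Matrix.mul_one]
        _ = _ := by simp only [Matrix.mul_assoc]
    rw [hQM, h1] at h2
    rw [h2]
    simp only [Matrix.mul_assoc]

theorem phase_lt {I : Type*} [Fintype I] [DecidableEq I] {M T : Matrix I I ℂ} {θ : I → ℝ}
    (hM : ∀ v, v ≠ 0 → 0 < (star v ⬝ᵥ (M *ᵥ v)).re) (hT : IsUnit T)
    (hθ : ∀ i, θ i ∈ Set.Ioc (-Real.pi) Real.pi)
    (h : M = Tᴴ * Matrix.diagonal (fun i => Complex.exp (Complex.I * θ i)) * T) (i : I) :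
    θ i ∈ Set.Ioo (-(Real.pi / 2)) (Real.pi / 2) := by
  have hdet : IsUnit T.det := (Matrix.isUnit_iff_isUnit_det T).1 hT
  let v : I → ℂ := T⁻¹ *ᵥ Pi.single i 1
  have hTv : T *ᵥ v = Pi.single i 1 := by
    rw [Matrix.mulVec_mulVec, Matrix.mul_nonsing_inv _ hdet, Matrix.one_mulVec]
  have hv : v ≠ 0 := by
    intro h0
    rw [h0, Matrix.mulVec_zero] at hTv
    simpa using congrFun hTv i
  have hpos := hM v hv
  have hval : star v ⬝ᵥ (M *ᵥ v) = Complex.exp (Complex.I * θ i) := by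
    rw [h, ← Matrix.mulVec_mulVec, ← Matrix.mulVec_mulVec, Matrix.dotProduct_mulVec,
      ← Matrix.star_mulVec, hTv]
    simp
  rw [hval, mul_comm, Complex.exp_ofReal_mul_I_re] at hpos
  constructor
  · by_contra! hc
    have := Real.cos_nonpos_of_pi_div_two_le_of_le (x := -θ i) (by linarith)
      (by linarith [(hθ i).1, Real.pi_pos])
    rw [Real.cos_neg] at this
    linarith
  · by_contra! hc
    have := Real.cos_nonpos_of_pi_div_two_le_of_le hc (by linarith [(hθ i).2, Real.pi_pos])
    linarith

theorem phases_eq {I : Type*} [Fintype I] [DecidableEq I] {M S T : Matrix I I ℂ} {θ η : I → ℝ}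
    (hS : IsUnit S) (hT : IsUnit T)
    (hθ : ∀ i, θ i ∈ Set.Ioo (-(Real.pi / 2)) (Real.pi / 2))
    (hη : ∀ i, η i ∈ Set.Ioo (-(Real.pi / 2)) (Real.pi / 2))
    (h : M = Tᴴ * Matrix.diagonal (fun i => Complex.exp (Complex.I * θ i)) * T)
    (h' : M = Sᴴ * Matrix.diagonal (fun i => Complex.exp (Complex.I * η i)) * S) :
    Multiset.map θ Finset.univ.val = Multiset.map η Finset.univ.val := by
  have key : ∀ (R : Matrix I I ℂ) (ζ : I → ℝ), IsUnit R →
      (∀ i, ζ i ∈ Set.Ioo (-(Real.pi / 2)) (Real.pi / 2)) →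
      M = Rᴴ * Matrix.diagonal (fun i => Complex.exp (Complex.I * ζ i)) * R →
      Multiset.map ζ Finset.univ.val =
        Multiset.map (fun z => Complex.arg z / 2) (Mᴴ⁻¹ * M).charpoly.roots := by
    intro R ζ hR hζ hM
    have hdet : IsUnit R.det := (Matrix.isUnit_iff_isUnit_det R).1 hR
    have hdet' : IsUnit Rᴴ.det := by rw [Matrix.det_conjTranspose]; exact hdet.star
    have hD : (Matrix.diagonal (fun i => Complex.exp (Complex.I * ζ i)))ᴴ⁻¹ =
        Matrix.diagonal (fun i => Complex.exp (Complex.I * ζ i)) := by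
      apply Matrix.inv_eq_left_inv
      rw [Matrix.diagonal_conjTranspose, Matrix.diagonal_mul_diagonal, ← Matrix.diagonal_one]
      congr 1
      ext i
      rw [Pi.star_apply, RCLike.star_def, ← Complex.exp_conj, ← Complex.exp_add]
      simp
    have hN : Mᴴ⁻¹ * M = R⁻¹ * (Matrix.diagonal (fun i => Complex.exp (Complex.I * ζ i)) *
        Matrix.diagonal (fun i => Complex.exp (Complex.I * ζ i)) * R) := by
      have e1 : Mᴴ⁻¹ = R⁻¹ * (Matrix.diagonal (fun i => Complex.exp (Complex.I * ζ i)) *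
          Rᴴ⁻¹) := by
        rw [hM, Matrix.conjTranspose_mul, Matrix.conjTranspose_mul,
          Matrix.conjTranspose_conjTranspose, Matrix.mul_inv_rev, Matrix.mul_inv_rev, hD,
          Matrix.mul_assoc]
      rw [e1]
      conv_lhs => rw [hM]
      simp only [Matrix.mul_assoc]
      rw [← Matrix.mul_assoc Rᴴ⁻¹, Matrix.nonsing_inv_mul _ hdet', Matrix.one_mul]
    rw [hN, Matrix.charpoly_mul_comm, Matrix.mul_assoc, Matrix.mul_nonsing_inv _ hdet,
      Matrix.mul_one, Matrix.diagonal_mul_diagonal, Matrix.charpoly_diagonal,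
      Polynomial.roots_prod _ _ (Finset.prod_ne_zero_iff.2 fun i _ => Polynomial.X_sub_C_ne_zero _)]
    simp only [Polynomial.roots_X_sub_C, Multiset.bind_singleton, Multiset.map_map]
    refine Multiset.map_congr rfl fun i _ => ?_
    have : Complex.exp (Complex.I * ζ i) * Complex.exp (Complex.I * ζ i) =
        Complex.exp ((2 * ζ i : ℝ) * Complex.I) := by
      rw [← Complex.exp_add]; congr 1; push_cast; ring
    simp only [Function.comp_apply]
    rw [this, Complex.arg_exp_mul_I, (toIocMod_eq_self _).2]
    · ring
    · constructor <;> linarith [(hζ i).1, (hζ i).2]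
  rw [key T θ hT hθ h, key S η hS hη h']

/-- A strictly accretive tensor has exactly one canonical T-phase vector. -/
theorem existsUnique_isPhaseVector {A : Tensor3 n n p} (hA : A ∈ TPlus n p) :
    ∃! φ, IsPhaseVector A φ := by
  refine existsUnique_of_exists_of_unique ?_ ?_
  · obtain ⟨T, θ, hT, hθ, h⟩ := exists_diagonalization _ (bcirc_pos hA)
    let e₀ : Fin p × Fin n ≃ Fin (n * p) :=
      finProdFinEquiv.trans (finCongr (Nat.mul_comm p n))
    let f : Fin (n * p) → ℝ := fun k => - θ (e₀.symm k)
    let σ := Tuple.sort f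
    refine ⟨fun k => θ (e₀.symm (σ k)), ?_, ?_, ?_, T, e₀.trans σ.symm, hT, ?_⟩
    · intro k l hkl
      have := Tuple.monotone_sort f hkl
      simpa [f] using this
    · intro k
      have := hθ (e₀.symm (σ k))
      constructor <;> linarith [this.1, this.2, Real.pi_pos]
    · intro k l
      linarith [(hθ (e₀.symm (σ k))).2, (hθ (e₀.symm (σ l))).1]
    · simpa using h
  · rintro φ ψ ⟨hφ, hφ1, -, T, e, hT, h⟩ ⟨hψ, hψ1, -, S, e', hS, h'⟩
    have a1 := phase_lt (θ := fun x => φ (e x)) (bcirc_pos hA) hT (fun x => hφ1 _) h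
    have a2 := phase_lt (θ := fun x => ψ (e' x)) (bcirc_pos hA) hS (fun x => hψ1 _) h'
    have key := phases_eq (θ := fun x => φ (e x)) (η := fun x => ψ (e' x)) hS hT a1 a2 h h'
    have r : ∀ (g : Fin (n * p) → ℝ) (e : Fin p × Fin n ≃ Fin (n * p)),
        Multiset.map (fun x => g (e x)) Finset.univ.val = (List.ofFn g : Multiset ℝ) := by
      intro g e
      have : Multiset.map (fun x => g (e x)) Finset.univ.val
          = Multiset.map g (Multiset.map e Finset.univ.val) := by
        rw [Multiset.map_map]; rfl
      rw [this, Multiset.map_univ_val_equiv]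
      simp [List.ofFn_eq_map, Fin.univ_def]
    rw [r, r, Multiset.coe_eq_coe] at key
    exact List.ofFn_injective
      (key.eq_of_pairwise' hφ.sortedGE_ofFn.pairwise hψ.sortedGE_ofFn.pairwise)

end Tensor3

end

/-! ### Resolvents, parametric integrals and an inverse square root in a Banach algebra. -/

section BanachAlgebra

/-! The map `bcirc` is an injective homomorphism from the T-product to matrix multiplication and
carries `TPlus` to strictly accretive matrices, so the problem is one about matrices `A`, `B` with
positive definite Hermitian part. The substitution `t = tan θ` turns the defining integral into that
of `(sin² θ A + cos² θ B)⁻¹` over `[0, π/2]`. The integrand is continuous and accretive, which gives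
convergence, invertibility and `G = A # B` accretive.

The integral is used only through the Riccati equation `G A⁻¹ G = B` (`integral_inv_riccati`).
Factoring `(A + B)/2` out of the integrand reduces it to `integral_resolvent_sq`, which evaluates
the integral as an inverse square root.

A congruence makes `G` a diagonal unitary `D` with phases `θ`, so that `D A⁻¹ D = B`. A principal
submatrix on an index set `f` satisfies an equation of the same shape, because `D` is diagonal.
Comparing arguments of determinants on a continuous branch (`phaseSum_phaseDiag_mul_mul`) makes `2 ∑
θ (f i)` the sum of the phase sums of the compressions of `B` and of `(A⁻¹)ᴴ`, and `(A⁻¹)ᴴ` is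
congruent to `A`. Interlacing (`phaseSum_compression_le`) bounds these by the sums of the largest
phases of `B` and `A`, with equality for the full index set. Hence `θ` is majorized by half the sum
of the two sorted phase vectors, and is a convex combination of its permutations
(`mem_convexHull_of_majorized`). The properties of a symmetric gauge finish the proof. -/

theorem Commute.right_ringInverse {R : Type*} [Ring R] {X U : R} (hU : IsUnit U)
    (h : Commute X U) : Commute X (Ring.inverse U) := by
  obtain ⟨u, rfl⟩ := hU
  rw [Ring.inverse_unit]
  exact h.units_inv_right

theorem continuous_ringInverse_comp {R Y : Type*} [NormedRing R] [CompleteSpace R]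
    [TopologicalSpace Y] {f : Y → R} (hf : Continuous f) (hu : ∀ y, IsUnit (f y)) :
    Continuous fun y => Ring.inverse (f y) := by
  refine continuous_iff_continuousAt.2 fun y => ?_
  obtain ⟨u, hu⟩ := hu y
  have := NormedRing.inverse_continuousAt u
  rw [hu] at this
  exact this.comp hf.continuousAt

theorem HasDerivAt.ringInverse_comp {R : Type*} [NormedRing R] [NormedAlgebra ℝ R]
    [CompleteSpace R] {f : ℝ → R} {f' : R} {x : ℝ} (hf : HasDerivAt f f' x)
    (hu : IsUnit (f x)) :
    HasDerivAt (fun y => Ring.inverse (f y)) (-(Ring.inverse (f x) * f' * Ring.inverse (f x)))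
      x := by
  obtain ⟨u, hu⟩ := hu
  have := hasFDerivAt_ringInverse (𝕜 := ℝ) u
  have h2 : Ring.inverse (f x) = ↑u⁻¹ := by rw [← hu, Ring.inverse_unit]
  rw [hu] at this
  have := this.comp_hasDerivAt x hf
  rw [h2]
  exact this

/-- Differentiation under the integral sign for a jointly continuous derivative. -/
theorem hasDerivAt_intervalIntegral_of_continuous {E : Type*} [NormedAddCommGroup E]
    [NormedSpace ℝ E] {F F' : ℝ → ℝ → E} {a b : ℝ}
    (hF : Continuous (Function.uncurry F)) (hF' : Continuous (Function.uncurry F'))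
    (h : ∀ x t, HasDerivAt (fun x => F x t) (F' x t) x) (x : ℝ) :
    HasDerivAt (fun x => ∫ t in a..b, F x t) (∫ t in a..b, F' x t) x := by
  have hs : ∀ {G : ℝ → ℝ → E}, Continuous (Function.uncurry G) → ∀ x, Continuous (G x) :=
    fun hG x => hG.comp (Continuous.prodMk_right x)
  obtain ⟨C, hC⟩ := ((isCompact_closedBall x 1).prod
    (isCompact_uIcc (a := a) (b := b))).exists_bound_of_continuousOn hF'.continuousOn
  refine (intervalIntegral.hasDerivAt_integral_of_dominated_loc_of_deriv_le
    (bound := fun _ => C) (Metric.closedBall_mem_nhds x one_pos)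
    (.of_forall fun y => (hs hF y).aestronglyMeasurable) ((hs hF x).intervalIntegrable _ _)
    (hs hF' x).aestronglyMeasurable (.of_forall fun t ht y hy => ?_)
    intervalIntegrable_const (.of_forall fun t _ y _ => h y t)).2
  exact hC (y, t) ⟨hy, Set.uIoc_subset_uIcc ht⟩

/-- For `c = cos 2θ` and `s = sin w` the right side is the `θ`-derivative of `(sin 2θ / 2) X Y`. The
left side is the integrand of the differential equation in `w` for the integral of `Y`, which is
thereby exact. -/
theorem resolvent_deriv_identity_comm {R : Type*} [CommRing R] [Algebra ℝ R] {X Y : R} {s c : ℝ}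
    (h : Y * (1 - (s * c) • X) = 1) :
    (c • (Y * X * Y)) * (1 - s ^ 2 • (X * X)) - s • (X * X * Y) =
      c • (X * Y) - (s * (1 - c ^ 2)) • (X * Y * X * Y) := by
  simp only [Algebra.smul_def, map_mul, map_sub, map_one, map_pow] at h ⊢
  linear_combination (algebraMap ℝ R s * X ^ 2 + algebraMap ℝ R c * X) * Y * h

open scoped IsMulCommutative in
-- Commuting `X` and `Y` generate a commutative subalgebra, where the polynomial identity can be
-- checked.
theorem resolvent_deriv_identity {R : Type*} [Ring R] [Algebra ℝ R] {X Y : R} {s c : ℝ}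
    (h : Y * (1 - (s * c) • X) = 1) (hXY : X * Y = Y * X) :
    (c • (Y * X * Y)) * (1 - s ^ 2 • (X * X)) - s • (X * X * Y) =
      c • (X * Y) - (s * (1 - c ^ 2)) • (X * Y * X * Y) := by
  let S := Algebra.adjoin ℝ {X, Y}
  have hcomm : ∀ a ∈ ({X, Y} : Set R), ∀ b ∈ ({X, Y} : Set R), a * b = b * a := by
    rintro a (rfl | rfl) b (rfl | rfl) <;> first | rfl | exact hXY | exact hXY.symm
  have : IsMulCommutative S := Algebra.isMulCommutative_adjoin ℝ hcomm
  let x : S := ⟨X, Algebra.subset_adjoin (by simp)⟩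
  let y : S := ⟨Y, Algebra.subset_adjoin (by simp)⟩
  have key := resolvent_deriv_identity_comm (X := x) (Y := y) (s := s) (c := c)
    (Subtype.ext h)
  exact congrArg Subtype.val key

variable {R : Type*} [NormedRing R] [NormedAlgebra ℝ R] [CompleteSpace R]

theorem intervalIntegral_const_mul_algebra {f : ℝ → R} (hf : Continuous f) (X : R) (a b : ℝ) :
    ∫ t in a..b, X * f t = X * ∫ t in a..b, f t :=
  (ContinuousLinearMap.mul ℝ R X).intervalIntegral_comp_comm (hf.intervalIntegrable a b)

theorem intervalIntegral_mul_const_algebra {f : ℝ → R} (hf : Continuous f) (X : R) (a b : ℝ) :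
    ∫ t in a..b, f t * X = (∫ t in a..b, f t) * X :=
  ((ContinuousLinearMap.mul ℝ R).flip X).intervalIntegral_comp_comm (hf.intervalIntegrable a b)

theorem commute_intervalIntegral {f : ℝ → R} (hf : Continuous f) {X : R}
    (h : ∀ t, Commute X (f t)) (a b : ℝ) : Commute X (∫ t in a..b, f t) := by
  rw [Commute, SemiconjBy, ← intervalIntegral_const_mul_algebra hf,
    ← intervalIntegral_mul_const_algebra hf]
  exact intervalIntegral.integral_congr fun t _ => h t

open Real in
/-- If the spectrum of `X` avoids `(-∞, -1] ∪ [1, ∞)`, then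
`(2 / π) ∫ (1 - cos 2θ • X)⁻¹ dθ` over `[0, π / 2]` is `(1 - X ^ 2) ^ (-1 / 2)`. -/
theorem integral_resolvent_sq {X : R} (hX : ∀ c ∈ Set.Icc (-1 : ℝ) 1, IsUnit (1 - c • X)) :
    Commute X (∫ θ in (0 : ℝ)..(π / 2), Ring.inverse (1 - cos (2 * θ) • X)) ∧
    (∫ θ in (0 : ℝ)..(π / 2), Ring.inverse (1 - cos (2 * θ) • X)) *
      (∫ θ in (0 : ℝ)..(π / 2), Ring.inverse (1 - cos (2 * θ) • X)) * (1 - X * X) =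
        ((π / 2) ^ 2) • (1 : R) := by
  -- Deform `X` to `sin w • X`: the claim is trivial at `w = 0` and is the desired one at `w = π /
  -- 2`. Using `sin w` as the scale keeps the coefficient of `X` in `[-1, 1]` for every real `w`, so
  -- the resolvents exist globally.
  obtain ⟨Y, hY⟩ : ∃ Y : ℝ → ℝ → R, ∀ w θ,
      Y w θ = Ring.inverse (1 - (sin w * cos (2 * θ)) • X) := ⟨_, fun _ _ => rfl⟩
  have hu : ∀ w θ, IsUnit (1 - (sin w * cos (2 * θ)) • X) := fun w θ => by
    refine hX _ (abs_le.1 ?_)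
    rw [abs_mul]
    exact mul_le_one₀ (abs_sin_le_one _) (abs_nonneg _) (abs_cos_le_one _)
  have hYc : Continuous (Function.uncurry Y) := by
    simp only [Function.uncurry_def, hY]
    exact continuous_ringInverse_comp (f := fun q : ℝ × ℝ => 1 - (sin q.1 * cos (2 * q.2)) • X)
      (by fun_prop) fun q => hu q.1 q.2
  have hYs : ∀ w, Continuous (Y w) := fun w => hYc.uncurry_left w
  have hcomm : ∀ w θ, Commute X (Y w θ) := fun w θ => hY w θ ▸
    Commute.right_ringInverse (hu w θ)
      ((Commute.one_right X).sub_right ((Commute.refl X).smul_right _))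
  obtain ⟨Z, hZ⟩ : ∃ Z : ℝ → ℝ → R, ∀ w θ, Z w θ = cos (2 * θ) • (Y w θ * X * Y w θ) :=
    ⟨_, fun _ _ => rfl⟩
  have hZc : Continuous (Function.uncurry Z) := by
    simp only [Function.uncurry_def, hZ] at hYc ⊢
    fun_prop
  have hZs : ∀ w, Continuous (Z w) := fun w => hZc.uncurry_left w
  have hZcomm : ∀ w θ, Commute X (Z w θ) := fun w θ => hZ w θ ▸
    (((hcomm w θ).mul_right (Commute.refl X)).mul_right (hcomm w θ)).smul_right _
  obtain ⟨Q, hQ⟩ : ∃ Q : ℝ → R, ∀ w, Q w = ∫ θ in (0 : ℝ)..(π / 2), Y w θ := ⟨_, fun _ => rfl⟩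
  obtain ⟨Q', hQ'⟩ : ∃ Q' : ℝ → R, ∀ w, Q' w = ∫ θ in (0 : ℝ)..(π / 2), Z w θ :=
    ⟨_, fun _ => rfl⟩
  have hQX : ∀ w, Commute X (Q w) := fun w => by
    rw [hQ]; exact commute_intervalIntegral (hYs w) (hcomm w) _ _
  have hYd : ∀ w θ, HasDerivAt (fun w => Y w θ) (cos w • Z w θ) w := fun w θ => by
    have h1 : HasDerivAt (fun w => 1 - (sin w * cos (2 * θ)) • X)
        (-((cos w * cos (2 * θ)) • X)) w := by
      simpa using (((hasDerivAt_sin w).mul_const (cos (2 * θ))).smul_const X).const_sub 1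
    have h2 := h1.ringInverse_comp (hu w θ)
    simp only [← hY] at h2
    convert h2 using 1
    simp [hZ, smul_smul]
  have hQd : ∀ w, HasDerivAt Q (cos w • Q' w) w := fun w => by
    have := hasDerivAt_intervalIntegral_of_continuous (F := Y) (F' := fun w θ => cos w • Z w θ)
      (a := 0) (b := π / 2) hYc
      (by
        simp only [Function.uncurry_def] at hZc ⊢
        fun_prop) hYd w
    rwa [intervalIntegral.integral_smul, ← hQ', ← funext hQ] at this
  -- The difference of the two sides is the integral of an exact derivative, whose primitive carries
  -- the factor `sin 2θ` and so vanishes at both endpoints.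
  have hQQ : ∀ w, Q' w * (1 - sin w ^ 2 • (X * X)) = sin w • (X * X * Q w) := fun w => by
    have hd : ∀ θ, HasDerivAt (fun θ => (sin (2 * θ) / 2) • (X * Y w θ))
        (Z w θ * (1 - sin w ^ 2 • (X * X)) - sin w • (X * X * Y w θ)) θ := fun θ => by
      have hc2 : HasDerivAt (fun θ => cos (2 * θ)) (-sin (2 * θ) * 2) θ := by
        simpa using ((hasDerivAt_id θ).const_mul 2).cos
      have hs2 : HasDerivAt (fun θ => sin (2 * θ) / 2) (cos (2 * θ)) θ := by
        simpa using (((hasDerivAt_id θ).const_mul 2).sin).div_const 2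
      have h1 : HasDerivAt (fun θ => 1 - (sin w * cos (2 * θ)) • X)
          (-((sin w * (-sin (2 * θ) * 2)) • X)) θ := by
        simpa using ((hc2.const_mul (sin w)).smul_const X).const_sub 1
      have h2 := hs2.smul ((h1.ringInverse_comp (hu w θ)).const_mul X)
      simp only [← hY] at h2
      refine HasDerivAt.congr_deriv h2 ?_
      rw [hZ, resolvent_deriv_identity (hY w θ ▸ Ring.inverse_mul_cancel _ (hu w θ))
        (hcomm w θ).eq, ← Real.sin_sq]
      simp only [mul_neg, neg_mul, neg_neg, mul_smul_comm, smul_mul_assoc, smul_neg, neg_smul,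
        smul_smul, mul_assoc]
      rw [add_comm, sub_eq_add_neg]
      congr 3
      ring
    have hcont : Continuous fun θ =>
        Z w θ * (1 - sin w ^ 2 • (X * X)) - sin w • (X * X * Y w θ) := by
      have := hZs w
      have := hYs w
      fun_prop
    have := intervalIntegral.integral_eq_sub_of_hasDerivAt (a := 0) (b := π / 2)
      (fun θ _ => hd θ) (hcont.intervalIntegrable _ _)
    rw [intervalIntegral.integral_sub, intervalIntegral_mul_const_algebra (hZs w),
      intervalIntegral.integral_smul, intervalIntegral_const_mul_algebra (hYs w), ← hQ,
      ← hQ'] at this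
    · simpa [mul_div_cancel₀, sub_eq_zero] using this
    · exact ((hZs w).mul continuous_const).intervalIntegrable _ _
    · exact ((continuous_const.mul (hYs w)).const_smul _).intervalIntegrable _ _
  -- By `hQQ`, the two terms from differentiating `Q w * Q w` cancel the one from the last factor.
  have hconst : ∀ w, HasDerivAt (fun w => Q w * Q w * (1 - sin w ^ 2 • (X * X))) 0 w := fun w => by
    have h1 : HasDerivAt (fun w => 1 - sin w ^ 2 • (X * X))
        (-((2 * sin w * cos w) • (X * X))) w := by
      simpa using (((hasDerivAt_sin w).pow 2).smul_const (X * X)).const_sub 1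
    refine HasDerivAt.congr_deriv (((hQd w).mul (hQd w)).mul h1) ?_
    have c1 : Commute (Q w) (1 - sin w ^ 2 • (X * X)) :=
      (Commute.one_right _).sub_right
        ((((hQX w).symm.mul_right (hQX w).symm)).smul_right _)
    have c2 : Commute (Q w) (X * X) := (hQX w).symm.mul_right (hQX w).symm
    have e1 : Q' w * Q w * (1 - sin w ^ 2 • (X * X)) = sin w • (Q w * Q w * (X * X)) := by
      rw [mul_assoc, c1.eq, ← mul_assoc, hQQ, smul_mul_assoc, ← c2.eq, mul_assoc, ← c2.eq,
        mul_assoc]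
    have e2 : Q w * Q' w * (1 - sin w ^ 2 • (X * X)) = sin w • (Q w * Q w * (X * X)) := by
      rw [mul_assoc, hQQ, mul_smul_comm, ← c2.eq, mul_assoc]
    rw [add_mul, smul_mul_assoc, mul_smul_comm, smul_mul_assoc, smul_mul_assoc, e1, e2, mul_neg,
      mul_smul_comm, smul_smul, ← add_smul, ← sub_eq_add_neg, Pi.mul_apply, ← sub_smul]
    rw [show cos w * sin w + cos w * sin w - 2 * sin w * cos w = 0 by ring, zero_smul]
  have hval := is_const_of_deriv_eq_zero (fun w => (hconst w).differentiableAt)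
    (fun w => (hconst w).deriv) (π / 2) 0
  have h1 : Q (π / 2) = ∫ θ in (0 : ℝ)..(π / 2), Ring.inverse (1 - cos (2 * θ) • X) := by
    simp [hQ, hY]
  have h0 : Q 0 = (π / 2) • (1 : R) := by simp [hQ, hY]
  rw [h0, sin_zero, sin_pi_div_two, h1] at hval
  refine ⟨h1 ▸ hQX (π / 2), ?_⟩
  simpa [smul_smul, sq] using hval

end BanachAlgebra

/-! ### Stability properties of strictly accretive matrices. -/

/-- A complex matrix is strictly accretive if its Hermitian part is positive definite. -/
def IsAccretive {I : Type*} [Fintype I] (M : Matrix I I ℂ) : Prop :=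
  ∀ v : I → ℂ, v ≠ 0 → 0 < (star v ⬝ᵥ (M *ᵥ v)).re

namespace IsAccretive

variable {I J : Type*} [Fintype I] [Fintype J] {M N : Matrix I I ℂ}

theorem smul (hM : IsAccretive M) {c : ℝ} (hc : 0 < c) : IsAccretive (c • M) := fun v hv => by
  rw [Matrix.smul_mulVec, dotProduct_smul, Complex.real_smul, Complex.re_ofReal_mul]
  exact mul_pos hc (hM v hv)

theorem add (hM : IsAccretive M) (hN : IsAccretive N) : IsAccretive (M + N) := fun v hv => by
  rw [Matrix.add_mulVec, dotProduct_add, Complex.add_re]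
  exact add_pos (hM v hv) (hN v hv)

theorem smul_add_smul (hM : IsAccretive M) (hN : IsAccretive N) {a b : ℝ} (ha : 0 ≤ a)
    (hb : 0 ≤ b) (hab : 0 < a + b) : IsAccretive (a • M + b • N) := by
  rcases ha.eq_or_lt with rfl | ha
  · simpa using hN.smul (by simpa using hab)
  · rcases hb.eq_or_lt with rfl | hb
    · simpa using hM.smul ha
    · exact (hM.smul ha).add (hN.smul hb)

theorem star_dotProduct_conjTranspose_mulVec (M : Matrix I I ℂ) (v : I → ℂ) :
    star v ⬝ᵥ (Mᴴ *ᵥ v) = conj (star v ⬝ᵥ (M *ᵥ v)) := by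
  rw [starRingEnd_apply, ← Matrix.star_dotProduct_star, star_star, Matrix.star_mulVec,
    ← Matrix.dotProduct_mulVec]

theorem conjTranspose (hM : IsAccretive M) : IsAccretive Mᴴ := fun v hv => by
  rw [star_dotProduct_conjTranspose_mulVec, Complex.conj_re]
  exact hM v hv

theorem star_dotProduct_congr (M : Matrix I I ℂ) (V : Matrix I J ℂ) (v : J → ℂ) :
    star v ⬝ᵥ ((Vᴴ * M * V) *ᵥ v) = star (V *ᵥ v) ⬝ᵥ (M *ᵥ (V *ᵥ v)) := by
  rw [← Matrix.mulVec_mulVec, ← Matrix.mulVec_mulVec, Matrix.dotProduct_mulVec,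
    ← Matrix.star_mulVec]

theorem congr (hM : IsAccretive M) {V : Matrix I J ℂ} (hV : ∀ v, V *ᵥ v = 0 → v = 0) :
    IsAccretive (Vᴴ * M * V) := fun v hv => by
  rw [star_dotProduct_congr]
  exact hM _ fun h => hv (hV v h)

variable [DecidableEq I]

theorem mulVec_injective_of_isUnit {V : Matrix I I ℂ} (hV : IsUnit V) (v : I → ℂ)
    (h : V *ᵥ v = 0) : v = 0 := by
  have := (Matrix.isUnit_iff_isUnit_det V).1 hV
  rw [← Matrix.one_mulVec v, ← Matrix.nonsing_inv_mul V this, ← Matrix.mulVec_mulVec, h,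
    Matrix.mulVec_zero]

theorem congr_unit (hM : IsAccretive M) {V : Matrix I I ℂ} (hV : IsUnit V) :
    IsAccretive (Vᴴ * M * V) :=
  hM.congr (mulVec_injective_of_isUnit hV)

theorem isUnit (hM : IsAccretive M) : IsUnit M := by
  rw [Matrix.isUnit_iff_isUnit_det, isUnit_iff_ne_zero]
  intro h
  obtain ⟨v, hv, h0⟩ := Matrix.exists_mulVec_eq_zero_iff.2 h
  have := hM v hv
  simp [h0] at this

theorem isUnit_det (hM : IsAccretive M) : IsUnit M.det :=
  (Matrix.isUnit_iff_isUnit_det M).1 hM.isUnit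

/-- Read as a congruence of `M` by `M⁻¹`: this gives accretivity of the inverse, and later shows
that inversion negates the phase sum. -/
theorem conjTranspose_inv_eq_congr (hM : IsAccretive M) : (M⁻¹)ᴴ = (M⁻¹)ᴴ * M * M⁻¹ := by
  rw [Matrix.mul_assoc, Matrix.mul_nonsing_inv _ hM.isUnit_det, Matrix.mul_one]

theorem inv (hM : IsAccretive M) : IsAccretive M⁻¹ := by
  have h := hM.congr_unit (Matrix.isUnit_nonsing_inv_iff.2 hM.isUnit)
  rw [← hM.conjTranspose_inv_eq_congr] at h
  simpa using h.conjTranspose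

theorem diagonal {d : I → ℂ} (hd : ∀ i, 0 < (d i).re) : IsAccretive (Matrix.diagonal d) :=
    fun v hv => by
  obtain ⟨i, hi⟩ := Function.ne_iff.1 hv
  have e : ∀ i, (star v i * (Matrix.diagonal d *ᵥ v) i).re = (d i).re * Complex.normSq (v i) := by
    intro i
    rw [Matrix.mulVec_diagonal, Pi.star_apply, RCLike.star_def, mul_left_comm,
      ← Complex.normSq_eq_conj_mul_self, Complex.re_mul_ofReal]
  rw [dotProduct, Complex.re_sum, Finset.sum_congr rfl fun i _ => e i]
  exact Finset.sum_pos' (fun i _ => mul_nonneg (hd i).le (Complex.normSq_nonneg _))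
    ⟨i, Finset.mem_univ _, mul_pos (hd i) (Complex.normSq_pos.2 hi)⟩

end IsAccretive

/-! ### From the T-product to block-circulant matrices. -/

namespace Tensor3

variable {m n s p : ℕ}

theorem mem_TPlus_iff {A : Tensor3 n n p} : A ∈ TPlus n p ↔ IsAccretive (bcirc A) := by
  refine ⟨fun hA v hv => bcirc_pos hA v hv, fun h X hX => ?_⟩
  have e : X = fun i _ k => (fun x : Fin p × Fin n => X x.2 0 x.1) (k, i) := by
    ext i j k
    rw [Subsingleton.elim j 0]
  have e2 := frobInner_tProd_eq A fun x => X x.2 0 x.1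
  rw [← e] at e2
  rw [e2]
  refine h _ fun h0 => hX ?_
  ext i j k
  rw [Subsingleton.elim j 0]
  exact congrFun h0 (k, i)

section

variable [NeZero p]

theorem bcirc_injective : Function.Injective (bcirc : Tensor3 m n p → _) := fun A B h => by
  ext i j k
  simpa [bcirc] using congrFun (congrFun h (k, i)) (0, j)

theorem bcirc_tOne : bcirc (tOne n p) = 1 := by
  ext ⟨k, i⟩ ⟨l, j⟩
  simp [bcirc, tOne, Matrix.one_apply, sub_eq_zero, and_comm]

/-- Both sides are the cyclic convolution of the frontal slices; the summation indices differ by the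
shift `l`. -/
theorem bcirc_tProd (A : Tensor3 m n p) (B : Tensor3 n s p) :
    bcirc (tProd A B) = bcirc A * bcirc B := by
  ext ⟨k, i⟩ ⟨l, j⟩
  simp only [bcirc, tProd, fold, unfold, Matrix.mul_apply, Matrix.of_apply,
    Fintype.sum_prod_type]
  refine Fintype.sum_equiv (Equiv.addRight l) _ _ fun q => ?_
  simp [sub_sub, add_comm]

theorem tProd_eq_iff (A : Tensor3 m n p) (B : Tensor3 n s p) (C : Tensor3 m s p) :
    tProd A B = C ↔ bcirc A * bcirc B = bcirc C := by
  rw [← bcirc_tProd, bcirc_injective.eq_iff]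

theorem isTInverse_iff {A X : Tensor3 n n p} : IsTInverse A X ↔ bcirc A * bcirc X = 1 := by
  rw [IsTInverse, tProd_eq_iff, tProd_eq_iff, bcirc_tOne, mul_eq_one_comm (a := bcirc X),
    and_self]

/-- Solving for the first block column gives a right T-inverse, and for square matrices one side
suffices. In particular the matrix inverse is again block-circulant. -/
theorem exists_isTInverse {A : Tensor3 n n p} (hA : IsUnit (bcirc A)) :
    ∃ X, IsTInverse A X := by
  refine ⟨fold ((bcirc A)⁻¹ * unfold (tOne n p)), ?_⟩
  rw [isTInverse_iff, ← bcirc_tOne, ← tProd_eq_iff]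
  have := (Matrix.isUnit_iff_isUnit_det _).1 hA
  change fold (bcirc A * ((bcirc A)⁻¹ * unfold (tOne n p))) = _
  rw [← Matrix.mul_assoc, Matrix.mul_nonsing_inv _ this, Matrix.one_mul]
  rfl

theorem isTInverse_tInv {A : Tensor3 n n p} (hA : IsUnit (bcirc A)) :
    IsTInverse A (tInv A) := by
  rw [tInv, dif_pos (exists_isTInverse hA)]
  exact (exists_isTInverse hA).choose_spec

theorem bcirc_tInv {A : Tensor3 n n p} (hA : IsUnit (bcirc A)) :
    bcirc (tInv A) = (bcirc A)⁻¹ :=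
  (Matrix.inv_eq_right_inv (isTInverse_iff.1 (isTInverse_tInv hA))).symm

end

/-- `bcirc` as a linear map. -/
def bcircLinear (m n p : ℕ) : Tensor3 m n p →ₗ[ℝ] Matrix (Fin p × Fin m) (Fin p × Fin n) ℂ where
  toFun := bcirc
  map_add' _ _ := rfl
  map_smul' _ _ := rfl

theorem bcirc_add (A B : Tensor3 m n p) : bcirc (A + B) = bcirc A + bcirc B := rfl

theorem bcirc_smul (c : ℝ) (A : Tensor3 m n p) : bcirc (c • A) = c • bcirc A := rfl

end Tensor3

/-! ### The integral of inverses and its Riccati equation. -/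

section MatrixIntegral

attribute [local instance] Matrix.linftyOpNormedRing Matrix.linftyOpNormedAlgebra

variable {I : Type*} [Fintype I] [DecidableEq I]

theorem continuous_matrix_inv {Y : Type*} [TopologicalSpace Y] {f : Y → Matrix I I ℂ}
    (hf : Continuous f) (hu : ∀ y, IsUnit (f y)) : Continuous fun y => (f y)⁻¹ := by
  simp only [Matrix.nonsing_inv_eq_ringInverse]
  exact continuous_ringInverse_comp hf hu

open Real in
theorem continuous_inv_sin_cos {A B : Matrix I I ℂ} (hA : IsAccretive A) (hB : IsAccretive B) :
    Continuous fun θ : ℝ => (sin θ ^ 2 • A + cos θ ^ 2 • B)⁻¹ :=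
  continuous_matrix_inv (by fun_prop) fun θ =>
    (hA.smul_add_smul hB (sq_nonneg _) (sq_nonneg _) (by simp)).isUnit

open Real in
/-- The Riccati equation satisfied by the integral defining the geometric mean. -/
theorem integral_inv_riccati {A B P : Matrix I I ℂ} (hA : IsAccretive A) (hB : IsAccretive B)
    (hP : P = ∫ θ in (0 : ℝ)..(π / 2), (sin θ ^ 2 • A + cos θ ^ 2 • B)⁻¹) :
    B * P * A * P = ((π / 2) ^ 2) • (1 : Matrix I I ℂ) := by
  have hS : IsAccretive ((1 / 2 : ℝ) • A + (1 / 2 : ℝ) • B) :=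
    hA.smul_add_smul hB (by norm_num) (by norm_num) (by norm_num)
  obtain ⟨S, hSdef⟩ : ∃ S, S = (1 / 2 : ℝ) • A + (1 / 2 : ℝ) • B := ⟨_, rfl⟩
  obtain ⟨D, hDdef⟩ : ∃ D, D = (1 / 2 : ℝ) • A - (1 / 2 : ℝ) • B := ⟨_, rfl⟩
  rw [← hSdef] at hS
  have hSl : S⁻¹ * S = 1 := Matrix.nonsing_inv_mul _ hS.isUnit_det
  have hSr : S * S⁻¹ = 1 := Matrix.mul_nonsing_inv _ hS.isUnit_det
  -- With `A = S (1 + X)` and `B = S (1 - X)`, the integrand becomes `(1 - cos 2θ X)⁻¹ S⁻¹`, so only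
  -- functions of the single element `X` remain to be integrated.
  obtain ⟨X, hX⟩ : ∃ X, X = S⁻¹ * D := ⟨_, rfl⟩
  have hSX : S * X = D := by rw [hX, ← Matrix.mul_assoc, hSr, Matrix.one_mul]
  have hAS : A = S * (1 + X) := by
    rw [mul_add, hSX, mul_one, hSdef, hDdef]; module
  have hBS : B = S * (1 - X) := by
    rw [mul_sub, hSX, mul_one, hSdef, hDdef]; module
  have hfac : ∀ c : ℝ, S * (1 - c • X) = ((1 - c) / 2) • A + ((1 + c) / 2) • B := fun c => by
    rw [mul_sub, mul_smul_comm, hSX, mul_one, hSdef, hDdef]; module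
  -- Up to the factor `S` this is a convex combination of `A` and `B`, hence accretive.
  have hunit : ∀ c ∈ Set.Icc (-1 : ℝ) 1, IsUnit (1 - c • X) := fun c hc => by
    have h := (hA.smul_add_smul hB (a := (1 - c) / 2) (b := (1 + c) / 2) (by linarith [hc.2])
      (by linarith [hc.1]) (by linarith)).isUnit
    rw [← hfac] at h
    have h2 := (Matrix.isUnit_nonsing_inv_iff.2 hS.isUnit).mul h
    rwa [← mul_assoc, hSl, one_mul] at h2
  obtain ⟨hcomm, hsq⟩ := integral_resolvent_sq hunit
  obtain ⟨Q, hQ⟩ : ∃ Q, Q = ∫ θ in (0 : ℝ)..(π / 2), Ring.inverse (1 - cos (2 * θ) • X) :=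
    ⟨_, rfl⟩
  rw [← hQ] at hcomm hsq
  have hcont : Continuous fun θ : ℝ => Ring.inverse (1 - cos (2 * θ) • X) :=
    continuous_ringInverse_comp (by fun_prop) fun θ => hunit _ ⟨neg_one_le_cos _, cos_le_one _⟩
  have hPQ : P = Q * S⁻¹ := by
    rw [hP, hQ, ← intervalIntegral_mul_const_algebra hcont]
    refine intervalIntegral.integral_congr fun θ _ => ?_
    have : sin θ ^ 2 • A + cos θ ^ 2 • B = S * (1 - cos (2 * θ) • X) := by
      rw [hfac, cos_two_mul, ← sin_sq_add_cos_sq θ]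
      congr 2 <;> ring
    simp only [this, Matrix.mul_inv_rev, ← Matrix.nonsing_inv_eq_ringInverse]
  have h1 : (1 - X) * Q * (1 + X) * Q = ((π / 2) ^ 2) • (1 : Matrix I I ℂ) := by
    rw [← hsq]
    have e1 : (1 - X) * Q = Q * (1 - X) := by rw [sub_mul, mul_sub, hcomm.eq, one_mul, mul_one]
    have e2 : (1 + X) * Q = Q * (1 + X) := by rw [add_mul, mul_add, hcomm.eq, one_mul, mul_one]
    rw [mul_assoc, e2, e1, mul_assoc, ← mul_assoc (1 - X), e1]
    simp only [mul_assoc]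
    congr 2
    noncomm_ring
  calc B * P * A * P = S * ((1 - X) * Q * (S⁻¹ * S) * (1 + X) * Q) * S⁻¹ := by
        rw [hPQ, hAS, hBS]; simp only [mul_assoc]
    _ = _ := by rw [hSl, mul_one, h1, mul_smul_comm, mul_one, smul_mul_assoc, hSr]

/-- For fixed `v`, the real part of the quadratic form is a continuous linear functional of the
matrix, so it passes under the integral. -/
theorem IsAccretive.intervalIntegral {f : ℝ → Matrix I I ℂ} (hf : Continuous f)
    (h : ∀ t, IsAccretive (f t)) {a b : ℝ} (hab : a < b) : IsAccretive (∫ t in a..b, f t) := by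
  intro v hv
  let L : Matrix I I ℂ →ₗ[ℝ] ℝ :=
    { toFun := fun M => (star v ⬝ᵥ (M *ᵥ v)).re
      map_add' := fun M N => by simp [Matrix.add_mulVec]
      map_smul' := fun c M => by simp [Matrix.smul_mulVec] }
  have e := L.toContinuousLinearMap.intervalIntegral_comp_comm
    (hf.intervalIntegrable (μ := MeasureTheory.volume) a b)
  refine lt_of_lt_of_eq (intervalIntegral.intervalIntegral_pos_of_pos ?_ (fun t => h t v hv) hab) e
  exact (L.toContinuousLinearMap.continuous.comp hf).intervalIntegrable _ _

/-! ### The geometric mean of tensors: convergence, invertibility, Riccati equation. -/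

namespace Tensor3

open Real MeasureTheory

variable {n p : ℕ} {A B : Tensor3 n n p}

theorem isAccretive_bcirc_smul_add (hA : A ∈ TPlus n p) (hB : B ∈ TPlus n p) {a b : ℝ}
    (ha : 0 ≤ a) (hb : 0 ≤ b) (hab : 0 < a + b) : IsAccretive (bcirc (a • A + b • B)) := by
  rw [bcirc_add, bcirc_smul, bcirc_smul]
  exact (mem_TPlus_iff.1 hA).smul_add_smul (mem_TPlus_iff.1 hB) ha hb hab

theorem isAccretive_bcirc_sin_cos (hA : A ∈ TPlus n p) (hB : B ∈ TPlus n p) (θ : ℝ) :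
    IsAccretive (bcirc (sin θ ^ 2 • A + cos θ ^ 2 • B)) :=
  isAccretive_bcirc_smul_add hA hB (sq_nonneg _) (sq_nonneg _) (by simp)

variable [NeZero p]

theorem tInv_smul {c : ℝ} (hc : c ≠ 0) (hA : IsUnit (bcirc A)) :
    tInv (c • A) = c⁻¹ • tInv A := by
  have h : bcirc (c • A) * bcirc (c⁻¹ • tInv A) = 1 := by
    rw [bcirc_smul, bcirc_smul, smul_mul_smul_comm, isTInverse_iff.1 (isTInverse_tInv hA),
      mul_inv_cancel₀ hc, one_smul]
  apply bcirc_injective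
  rw [bcirc_tInv (IsUnit.of_mul_eq_one _ h), Matrix.inv_eq_right_inv h]

theorem continuous_tInv_sin_cos (hA : A ∈ TPlus n p) (hB : B ∈ TPlus n p) :
    Continuous fun θ : ℝ => tInv (sin θ ^ 2 • A + cos θ ^ 2 • B) := by
  have h := continuous_inv_sin_cos (mem_TPlus_iff.1 hA) (mem_TPlus_iff.1 hB)
  refine continuous_pi fun i => continuous_pi fun j => continuous_pi fun k => ?_
  refine (h.matrix_elem (k, i) (0, j)).congr fun θ => ?_
  have := bcirc_tInv (isAccretive_bcirc_sin_cos hA hB θ).isUnit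
  rw [bcirc_add, bcirc_smul, bcirc_smul] at this
  rw [← this]
  simp [bcirc]

theorem tan_image_Ioo : tan '' Set.Ioo 0 (π / 2) = Set.Ioi 0 := by
  ext t
  constructor
  · rintro ⟨θ, hθ, rfl⟩
    exact tan_pos_of_pos_of_lt_pi_div_two hθ.1 hθ.2
  · intro ht
    exact ⟨arctan t, ⟨arctan_pos.2 ht, arctan_lt_pi_div_two t⟩, tan_arctan t⟩

/-- At `t = tan θ` the pencil is `(sin θ cos θ)⁻¹` times `sin² θ A + cos² θ B`. The Jacobian, the
weight `1 / t` and this scalar cancel exactly, leaving an integrand that extends continuously to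
`[0, π / 2]`. -/
theorem deriv_tan_smul_geomMeanIntegrand (hA : A ∈ TPlus n p) (hB : B ∈ TPlus n p) {θ : ℝ}
    (hθ : θ ∈ Set.Ioo 0 (π / 2)) :
    |1 / cos θ ^ 2| • geomMeanIntegrand A B (tan θ) =
      tInv (sin θ ^ 2 • A + cos θ ^ 2 • B) := by
  have hc : 0 < cos θ := cos_pos_of_mem_Ioo ⟨by linarith [hθ.1, pi_pos], hθ.2⟩
  have hs : 0 < sin θ := sin_pos_of_pos_of_lt_pi hθ.1 (by linarith [hθ.2, pi_pos])
  have e : tan θ • A + (tan θ)⁻¹ • B =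
      (sin θ * cos θ)⁻¹ • (sin θ ^ 2 • A + cos θ ^ 2 • B) := by
    rw [smul_add, smul_smul, smul_smul, tan_eq_sin_div_cos]
    congr 2 <;> field_simp
  rw [geomMeanIntegrand, e, tInv_smul (by positivity) (isAccretive_bcirc_sin_cos hA hB θ).isUnit,
    abs_of_pos (by positivity), smul_smul, smul_smul, tan_eq_sin_div_cos]
  convert one_smul ℝ _ using 2
  field_simp

theorem hasDerivWithinAt_tan_Ioo (θ : ℝ) (hθ : θ ∈ Set.Ioo 0 (π / 2)) :
    HasDerivWithinAt tan (1 / cos θ ^ 2) (Set.Ioo 0 (π / 2)) θ :=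
  (hasDerivAt_tan_of_mem_Ioo ⟨by linarith [hθ.1, pi_pos], hθ.2⟩).hasDerivWithinAt

theorem injOn_tan_Ioo : Set.InjOn tan (Set.Ioo 0 (π / 2)) :=
  Real.injOn_tan.mono (Set.Ioo_subset_Ioo_left (by linarith [pi_pos]))

theorem integrableOn_geomMeanIntegrand (hA : A ∈ TPlus n p) (hB : B ∈ TPlus n p) :
    IntegrableOn (geomMeanIntegrand A B) (Set.Ioi 0) := by
  rw [← tan_image_Ioo, integrableOn_image_iff_integrableOn_abs_deriv_smul measurableSet_Ioo
    hasDerivWithinAt_tan_Ioo injOn_tan_Ioo,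
    integrableOn_congr_fun (fun θ hθ => deriv_tan_smul_geomMeanIntegrand hA hB hθ)
      measurableSet_Ioo]
  exact ((continuous_tInv_sin_cos hA hB).integrableOn_Icc).mono_set Set.Ioo_subset_Icc_self

theorem geomMeanIntegral_eq (hA : A ∈ TPlus n p) (hB : B ∈ TPlus n p) :
    geomMeanIntegral A B =
      (2 / π) • ∫ θ in (0 : ℝ)..(π / 2), tInv (sin θ ^ 2 • A + cos θ ^ 2 • B) := by
  rw [geomMeanIntegral, ← tan_image_Ioo, integral_image_eq_integral_abs_deriv_smul
    measurableSet_Ioo hasDerivWithinAt_tan_Ioo injOn_tan_Ioo,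
    setIntegral_congr_fun measurableSet_Ioo
      (fun θ hθ => deriv_tan_smul_geomMeanIntegrand hA hB hθ),
    intervalIntegral.integral_of_le (by positivity), integral_Ioc_eq_integral_Ioo]

theorem bcirc_geomMeanIntegral (hA : A ∈ TPlus n p) (hB : B ∈ TPlus n p) :
    bcirc (geomMeanIntegral A B) = (2 / π) • ∫ θ in (0 : ℝ)..(π / 2),
      (sin θ ^ 2 • bcirc A + cos θ ^ 2 • bcirc B)⁻¹ := by
  have e := (bcircLinear n n p).toContinuousLinearMap.intervalIntegral_comp_comm
    ((continuous_tInv_sin_cos hA hB).intervalIntegrable (μ := volume) 0 (π / 2))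
  rw [geomMeanIntegral_eq hA hB, bcirc_smul]
  congr 1
  refine e.symm.trans (intervalIntegral.integral_congr fun θ _ => ?_)
  exact bcirc_tInv (isAccretive_bcirc_sin_cos hA hB θ).isUnit

theorem isAccretive_bcirc_geomMeanIntegral (hA : A ∈ TPlus n p) (hB : B ∈ TPlus n p) :
    IsAccretive (bcirc (geomMeanIntegral A B)) := by
  rw [bcirc_geomMeanIntegral hA hB]
  refine IsAccretive.smul (IsAccretive.intervalIntegral
    (continuous_inv_sin_cos (mem_TPlus_iff.1 hA) (mem_TPlus_iff.1 hB)) (fun θ => ?_)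
    (by positivity)) (by positivity)
  exact ((mem_TPlus_iff.1 hA).smul_add_smul (mem_TPlus_iff.1 hB) (sq_nonneg _) (sq_nonneg _)
    (by simp)).inv

theorem bcirc_geomMean (hA : A ∈ TPlus n p) (hB : B ∈ TPlus n p) :
    bcirc (geomMean A B) = (bcirc (geomMeanIntegral A B))⁻¹ :=
  bcirc_tInv (isAccretive_bcirc_geomMeanIntegral hA hB).isUnit

theorem isAccretive_bcirc_geomMean (hA : A ∈ TPlus n p) (hB : B ∈ TPlus n p) :
    IsAccretive (bcirc (geomMean A B)) := by
  rw [bcirc_geomMean hA hB]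
  exact (isAccretive_bcirc_geomMeanIntegral hA hB).inv

theorem geomMean_mem_TPlus (hA : A ∈ TPlus n p) (hB : B ∈ TPlus n p) :
    geomMean A B ∈ TPlus n p :=
  mem_TPlus_iff.2 (isAccretive_bcirc_geomMean hA hB)

theorem isTInverse_geomMean (hA : A ∈ TPlus n p) (hB : B ∈ TPlus n p) :
    IsTInverse (geomMean A B) (geomMeanIntegral A B) := by
  rw [isTInverse_iff, bcirc_geomMean hA hB]
  exact Matrix.nonsing_inv_mul _ (isAccretive_bcirc_geomMeanIntegral hA hB).isUnit_det

/-- The geometric mean solves the Riccati equation `G A⁻¹ G = B`. -/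
theorem bcirc_geomMean_riccati (hA : A ∈ TPlus n p) (hB : B ∈ TPlus n p) :
    bcirc (geomMean A B) * (bcirc A)⁻¹ * bcirc (geomMean A B) = bcirc B := by
  have hP := isAccretive_bcirc_geomMeanIntegral hA hB
  have key := integral_inv_riccati (mem_TPlus_iff.1 hA) (mem_TPlus_iff.1 hB) rfl
  have h1 : bcirc B * bcirc (geomMeanIntegral A B) * bcirc A *
      bcirc (geomMeanIntegral A B) = 1 := by
    rw [bcirc_geomMeanIntegral hA hB]
    simp only [mul_smul_comm, smul_mul_assoc, smul_smul, key]
    convert one_smul ℝ _ using 2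
    field_simp
  have hr := Matrix.nonsing_inv_mul _ hP.isUnit_det
  rw [← bcirc_geomMean hA hB] at hr
  have hr' := mul_eq_one_comm.1 hr
  have hA' := Matrix.mul_nonsing_inv _ (mem_TPlus_iff.1 hA).isUnit_det
  generalize bcirc (geomMean A B) = G at *
  generalize bcirc (geomMeanIntegral A B) = P at *
  calc G * (bcirc A)⁻¹ * G = (bcirc B * P * bcirc A * P) * G * (bcirc A)⁻¹ * G := by
        rw [h1, one_mul]
    _ = bcirc B * P * (bcirc A * (P * G) * (bcirc A)⁻¹) * G := by simp only [mul_assoc]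
    _ = bcirc B := by rw [hr', mul_one, hA', mul_one, mul_assoc, hr', mul_one]

end Tensor3

end MatrixIntegral

/-! ### A continuous branch of the argument of the determinant. -/

section PhaseSum

open Real

/-- The diagonal unitary matrix with phases `θ`. -/
noncomputable def phaseDiag {I : Type*} [DecidableEq I] (θ : I → ℝ) : Matrix I I ℂ :=
  Matrix.diagonal fun i => Complex.exp (Complex.I * θ i)

section

variable {I : Type*} [DecidableEq I]

theorem phaseDiag_conjTranspose (θ : I → ℝ) : (phaseDiag θ)ᴴ = phaseDiag (-θ) := by
  rw [phaseDiag, phaseDiag, Matrix.diagonal_conjTranspose]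
  congr 1
  ext i
  rw [Pi.star_apply, RCLike.star_def, ← Complex.exp_conj]
  simp

variable [Fintype I]

theorem phaseDiag_mul (θ η : I → ℝ) : phaseDiag θ * phaseDiag η = phaseDiag (θ + η) := by
  rw [phaseDiag, phaseDiag, phaseDiag, Matrix.diagonal_mul_diagonal]
  congr 1
  ext i
  rw [← Complex.exp_add]
  congr 1
  push_cast [Pi.add_apply]
  ring

theorem det_phaseDiag (θ : I → ℝ) :
    (phaseDiag θ).det = Complex.exp (Complex.I * ((∑ i, θ i : ℝ) : ℂ)) := by
  rw [phaseDiag, Matrix.det_diagonal, ← Complex.exp_sum, Complex.ofReal_sum, Finset.mul_sum]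

theorem isAccretive_phaseDiag {θ : I → ℝ} (hθ : ∀ i, θ i ∈ Set.Ioo (-(π / 2)) (π / 2)) :
    IsAccretive (phaseDiag θ) :=
  IsAccretive.diagonal fun i => by
    rw [mul_comm, Complex.exp_ofReal_mul_I_re]
    exact cos_pos_of_mem_Ioo (hθ i)

end

variable {I : Type*} [Fintype I]

/-- The Hermitian part is twice that of `M` for every real `r`. These matrices run from `M + Mᴴ` to
`2 M` as `r` goes from `0` to `1`, and the integrand of `phaseSum` is the logarithmic derivative of
their determinant. -/
theorem IsAccretive.add_smul_conjTranspose {M : Matrix I I ℂ} (hM : IsAccretive M) (r : ℝ) :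
    IsAccretive ((1 + r) • M + (1 - r) • Mᴴ) := fun v hv => by
  have := hM v hv
  rw [Matrix.add_mulVec, dotProduct_add, Matrix.smul_mulVec, Matrix.smul_mulVec, dotProduct_smul,
    dotProduct_smul, IsAccretive.star_dotProduct_conjTranspose_mulVec]
  simp only [Complex.add_re, Complex.real_smul, Complex.re_ofReal_mul, Complex.conj_re]
  linarith

variable [DecidableEq I]

/-- The continuous branch of the argument of the determinant on strictly accretive matrices. -/
noncomputable def phaseSum (M : Matrix I I ℂ) : ℝ :=
  (∫ r in (0 : ℝ)..1, ((M - Mᴴ) * ((1 + r) • M + (1 - r) • Mᴴ)⁻¹).trace).im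

theorem continuous_phaseSum {Y : Type*} [TopologicalSpace Y] {f : Y → Matrix I I ℂ}
    (hf : Continuous f) (h : ∀ y, IsAccretive (f y)) : Continuous fun y => phaseSum (f y) := by
  refine Complex.continuous_im.comp
    (intervalIntegral.continuous_parametric_intervalIntegral_of_continuous' ?_ 0 1)
  have h1 : Continuous fun q : Y × ℝ => f q.1 := hf.comp continuous_fst
  refine Continuous.matrix_trace (Continuous.mul ?_ (continuous_matrix_inv ?_ fun q =>
    ((h q.1).add_smul_conjTranspose q.2).isUnit))
  · exact h1.sub h1.matrix_conjTranspose
  · exact ((continuous_const.add continuous_snd).smul h1).add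
      ((continuous_const.sub continuous_snd).smul h1.matrix_conjTranspose)

/-- The integrand is the logarithmic derivative of `cos φ + i r sin φ`, a segment from `cos φ` to
`exp (i φ)` in the right half-plane, where the principal logarithm is a primitive. -/
theorem integral_phase {φ : ℝ} (hφ : φ ∈ Set.Ioo (-(π / 2)) (π / 2)) :
    (∫ r in (0 : ℝ)..1, ((2 * sin φ : ℝ) * Complex.I) /
      ((2 * cos φ : ℝ) + (2 * r * sin φ : ℝ) * Complex.I)).im = φ := by
  have hc := cos_pos_of_mem_Ioo hφ
  let g : ℝ → ℂ := fun r => (cos φ : ℝ) + (r : ℂ) * ((sin φ : ℝ) * Complex.I)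
  have hre : ∀ r, (g r).re = cos φ := fun r => by
    simp [g, -Complex.ofReal_cos, -Complex.ofReal_sin]
  have hs : ∀ r, g r ∈ Complex.slitPlane := fun r => Or.inl (by rw [hre]; exact hc)
  have hg : ∀ r, HasDerivAt g ((sin φ : ℝ) * Complex.I) r := fun r =>
    (((Complex.ofRealCLM.hasDerivAt (x := r)).mul_const
      (((sin φ : ℝ) : ℂ) * Complex.I)).const_add ((cos φ : ℝ) : ℂ)).congr_deriv (by simp)
  have hd : ∀ r, HasDerivAt (fun r => Complex.log (g r)) (((sin φ : ℝ) * Complex.I) / g r) r :=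
    fun r => (hg r).clog_real (hs r)
  have hgc : Continuous g := by fun_prop
  have hcont : Continuous fun r => ((sin φ : ℝ) * Complex.I) / g r :=
    continuous_const.div hgc fun r => Complex.slitPlane_ne_zero (hs r)
  have e := intervalIntegral.integral_eq_sub_of_hasDerivAt (a := 0) (b := 1) (fun r _ => hd r)
    (hcont.intervalIntegrable _ _)
  have e2 : ∀ r : ℝ, ((2 * sin φ : ℝ) * Complex.I) /
      ((2 * cos φ : ℝ) + (2 * r * sin φ : ℝ) * Complex.I) = ((sin φ : ℝ) * Complex.I) / g r := by
    intro r
    rw [← mul_div_mul_left _ (g r) two_ne_zero]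
    simp only [g]
    push_cast
    congr 1 <;> ring
  have h1 : g 1 = Complex.exp (φ * Complex.I) := by
    simp [g, Complex.exp_mul_I]
  have h0 : g 0 = (cos φ : ℝ) := by simp [g]
  rw [intervalIntegral.integral_congr fun r _ => e2 r, e, h1, h0, Complex.sub_im,
    Complex.log_im, Complex.log_im, Complex.arg_ofReal_of_nonneg hc.le, Complex.arg_exp_mul_I,
    (toIocMod_eq_self _).2, sub_zero]
  constructor <;> linarith [hφ.1, hφ.2]

theorem phaseSum_phaseDiag {θ : I → ℝ} (hθ : ∀ i, θ i ∈ Set.Ioo (-(π / 2)) (π / 2)) :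
    phaseSum (phaseDiag θ) = ∑ i, θ i := by
  have hne : ∀ (r : ℝ) (i : I),
      (((2 * cos (θ i) : ℝ) : ℂ) + (2 * r * sin (θ i) : ℝ) * Complex.I) ≠ 0 := fun r i h => by
    have := congrArg Complex.re h
    simp at this
    exact (cos_pos_of_mem_Ioo (hθ i)).ne' this
  have hexp : ∀ i, Complex.exp (Complex.I * θ i) =
      (cos (θ i) : ℝ) + (sin (θ i) : ℝ) * Complex.I := fun i => by
    rw [mul_comm, Complex.exp_mul_I]; simp
  have hexp' : ∀ i, conj (Complex.exp (Complex.I * θ i)) =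
      (cos (θ i) : ℝ) - (sin (θ i) : ℝ) * Complex.I := fun i => by
    rw [hexp, map_add, map_mul, Complex.conj_ofReal, Complex.conj_ofReal, Complex.conj_I]; ring
  have htr : ∀ r : ℝ, ((phaseDiag θ - (phaseDiag θ)ᴴ) *
      ((1 + r) • phaseDiag θ + (1 - r) • (phaseDiag θ)ᴴ)⁻¹).trace =
      ∑ i, ((2 * sin (θ i) : ℝ) * Complex.I) /
        ((2 * cos (θ i) : ℝ) + (2 * r * sin (θ i) : ℝ) * Complex.I) := by
    intro r
    have e1 : phaseDiag θ - (phaseDiag θ)ᴴ =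
        Matrix.diagonal fun i => ((2 * sin (θ i) : ℝ) : ℂ) * Complex.I := by
      rw [phaseDiag, Matrix.diagonal_conjTranspose, Matrix.diagonal_sub]
      congr 1
      ext i
      rw [Pi.star_apply, RCLike.star_def, hexp', hexp]
      push_cast; ring
    have e2 : (1 + r) • phaseDiag θ + (1 - r) • (phaseDiag θ)ᴴ =
        Matrix.diagonal fun i =>
          (((2 * cos (θ i) : ℝ) : ℂ) + (2 * r * sin (θ i) : ℝ) * Complex.I) := by
      rw [phaseDiag, Matrix.diagonal_conjTranspose, ← Matrix.diagonal_smul,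
        ← Matrix.diagonal_smul, Matrix.diagonal_add]
      congr 1
      ext i
      rw [Pi.smul_apply, Pi.smul_apply, Pi.star_apply, RCLike.star_def, hexp', hexp]
      simp only [Complex.real_smul]
      push_cast; ring
    have e3 : (Matrix.diagonal fun i =>
          (((2 * cos (θ i) : ℝ) : ℂ) + (2 * r * sin (θ i) : ℝ) * Complex.I))⁻¹ =
        Matrix.diagonal fun i =>
          (((2 * cos (θ i) : ℝ) : ℂ) + (2 * r * sin (θ i) : ℝ) * Complex.I)⁻¹ := by
      apply Matrix.inv_eq_right_inv
      rw [Matrix.diagonal_mul_diagonal, ← Matrix.diagonal_one]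
      congr 1
      ext i
      exact mul_inv_cancel₀ (hne r i)
    rw [e1, e2, e3, Matrix.diagonal_mul_diagonal, Matrix.trace_diagonal]
    rfl
  rw [phaseSum, intervalIntegral.integral_congr fun r _ => htr r,
    intervalIntegral.integral_finsetSum, Complex.im_sum]
  · exact Finset.sum_congr rfl fun i _ => integral_phase (hθ i)
  · intro i _
    refine Continuous.intervalIntegrable (continuous_const.div ?_ fun r => hne r i) _ _
    fun_prop

/-- A congruence of both factors turns `E F⁻¹` into a similar matrix, so the trace in the integrand
is unchanged. -/
theorem phaseSum_congr (M : Matrix I I ℂ) {T : Matrix I I ℂ} (hT : IsUnit T) :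
    phaseSum (Tᴴ * M * T) = phaseSum M := by
  have hdet : IsUnit T.det := (Matrix.isUnit_iff_isUnit_det T).1 hT
  have hdet' : IsUnit Tᴴ.det := by rw [Matrix.det_conjTranspose]; exact hdet.star
  have key : ∀ E F : Matrix I I ℂ,
      ((Tᴴ * E * T) * (Tᴴ * F * T)⁻¹).trace = (E * F⁻¹).trace := fun E F => by
    rw [Matrix.mul_inv_rev, Matrix.mul_inv_rev]
    calc (Tᴴ * E * T * (T⁻¹ * (F⁻¹ * Tᴴ⁻¹))).trace
        = (Tᴴ * E * (T * T⁻¹) * F⁻¹ * Tᴴ⁻¹).trace := by simp only [Matrix.mul_assoc]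
      _ = (Tᴴ⁻¹ * Tᴴ * (E * F⁻¹)).trace := by
        rw [Matrix.mul_nonsing_inv _ hdet, Matrix.mul_one, Matrix.trace_mul_comm]
        simp only [Matrix.mul_assoc]
      _ = _ := by rw [Matrix.nonsing_inv_mul _ hdet', Matrix.one_mul]
  rw [phaseSum, phaseSum]
  congr 1
  refine intervalIntegral.integral_congr fun r _ => ?_
  rw [← key (M - Mᴴ)]
  congr 3
  · simp [Matrix.mul_sub, Matrix.sub_mul, Matrix.mul_assoc]
  · simp [Matrix.mul_add, Matrix.add_mul, Matrix.mul_assoc]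

theorem phaseSum_eq {θ : I → ℝ} (hθ : ∀ i, θ i ∈ Set.Ioo (-(π / 2)) (π / 2))
    {T : Matrix I I ℂ} (hT : IsUnit T) : phaseSum (Tᴴ * phaseDiag θ * T) = ∑ i, θ i := by
  rw [phaseSum_congr _ hT, phaseSum_phaseDiag hθ]

theorem IsAccretive.exists_phaseDiag {M : Matrix I I ℂ} (hM : IsAccretive M) :
    ∃ (T : Matrix I I ℂ) (θ : I → ℝ), IsUnit T ∧ (∀ i, θ i ∈ Set.Ioo (-(π / 2)) (π / 2)) ∧
      M = Tᴴ * phaseDiag θ * T :=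
  Tensor3.exists_diagonalization M hM

theorem phaseSum_conjTranspose (M : Matrix I I ℂ) (hM : IsAccretive M) :
    phaseSum Mᴴ = -phaseSum M := by
  obtain ⟨T, θ, hT, hθ, rfl⟩ := hM.exists_phaseDiag
  have : (Tᴴ * phaseDiag θ * T)ᴴ = Tᴴ * phaseDiag (-θ) * T := by
    rw [Matrix.conjTranspose_mul, Matrix.conjTranspose_mul, Matrix.conjTranspose_conjTranspose,
      phaseDiag_conjTranspose, Matrix.mul_assoc]
  rw [this, phaseSum_eq hθ hT, phaseSum_eq (fun i => ?_) hT]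
  · simp
  · constructor <;> simp only [Pi.neg_apply] <;> linarith [(hθ i).1, (hθ i).2]

theorem IsAccretive.det_eq {M : Matrix I I ℂ} (hM : IsAccretive M) :
    ∃ ρ : ℝ, 0 < ρ ∧ M.det = ρ * Complex.exp (Complex.I * phaseSum M) := by
  obtain ⟨T, θ, hT, hθ, rfl⟩ := hM.exists_phaseDiag
  have hdet : T.det ≠ 0 := ((Matrix.isUnit_iff_isUnit_det T).1 hT).ne_zero
  refine ⟨Complex.normSq T.det, Complex.normSq_pos.2 hdet, ?_⟩
  rw [phaseSum_eq hθ hT, Matrix.det_mul, Matrix.det_mul, det_phaseDiag, Matrix.det_conjTranspose,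
    Complex.normSq_eq_conj_mul_self, RCLike.star_def]
  ring

/-- The quotient `f / (2π)` is continuous and integer-valued. -/
theorem eq_of_continuous_of_exp_eq_one {f : ℝ → ℝ} (hf : Continuous f)
    (h : ∀ x, Complex.exp (Complex.I * f x) = 1) (a b : ℝ) : f a = f b := by
  have hT : IsDiscrete (Set.range ((↑) : ℤ → ℝ)) :=
    ⟨(Int.isClosedEmbedding_coe_real.isEmbedding.toHomeomorph).symm.isEmbedding.discreteTopology⟩
  have hmem : ∀ x, f x / (2 * π) ∈ Set.range ((↑) : ℤ → ℝ) := fun x => by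
    obtain ⟨n, hn⟩ := Complex.exp_eq_one_iff.1 (h x)
    refine ⟨n, ?_⟩
    have := congrArg Complex.im hn
    simp at this
    rw [eq_div_iff (by positivity), this]
  have := isPreconnected_univ.constant_of_mapsTo hT (f := fun x => f x / (2 * π))
    (hf.div_const _).continuousOn (fun x _ => hmem x) (Set.mem_univ a) (Set.mem_univ b)
  simpa [div_left_inj' (by positivity : (2 * π) ≠ 0)] using this

/-- Multiplicativity of the determinant gives the equality modulo `2π`. The ambiguity is removed by
continuity along a path to a case where both sides are explicit. -/
theorem phaseSum_phaseDiag_mul_mul {θ : I → ℝ}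
    (hθ : ∀ i, θ i ∈ Set.Ioo (-(π / 2)) (π / 2)) {C : Matrix I I ℂ} (hC : IsAccretive C)
    (hDC : IsAccretive (phaseDiag θ * C * phaseDiag θ)) :
    phaseSum (phaseDiag θ * C * phaseDiag θ) = 2 * ∑ i, θ i + phaseSum C := by
  have hθ' : ∀ i, (-θ) i ∈ Set.Ioo (-(π / 2)) (π / 2) := fun i => by
    constructor <;> simp only [Pi.neg_apply] <;> linarith [(hθ i).1, (hθ i).2]
  -- The path starts at the inverse of `phaseDiag θ`, which is accretive and is sent to the
  -- accretive `phaseDiag θ`. Hence both `Cu u` and its image remain accretive, as nonnegative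
  -- combinations.
  let Cu : ℝ → Matrix I I ℂ := fun u => cos u ^ 2 • phaseDiag (-θ) + sin u ^ 2 • C
  have hCu : ∀ u, IsAccretive (Cu u) := fun u =>
    (isAccretive_phaseDiag hθ').smul_add_smul hC (sq_nonneg _) (sq_nonneg _) (by simp)
  have hDCD : ∀ u, phaseDiag θ * Cu u * phaseDiag θ =
      cos u ^ 2 • phaseDiag θ + sin u ^ 2 • (phaseDiag θ * C * phaseDiag θ) := fun u => by
    simp only [Cu, Matrix.mul_add, Matrix.add_mul, Matrix.mul_smul, Matrix.smul_mul,
      phaseDiag_mul, add_neg_cancel, zero_add]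
  have hDCu : ∀ u, IsAccretive (phaseDiag θ * Cu u * phaseDiag θ) := fun u => by
    rw [hDCD]
    exact (isAccretive_phaseDiag hθ).smul_add_smul hDC (sq_nonneg _) (sq_nonneg _) (by simp)
  have hc1 : Continuous Cu := by
    simp only [Cu]
    fun_prop
  have hc2 : Continuous fun u => phaseDiag θ * Cu u * phaseDiag θ :=
    (continuous_const.mul hc1).mul continuous_const
  let f : ℝ → ℝ := fun u =>
    phaseSum (phaseDiag θ * Cu u * phaseDiag θ) - 2 * ∑ i, θ i - phaseSum (Cu u)
  have hf : Continuous f :=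
    ((continuous_phaseSum hc2 hDCu).sub continuous_const).sub (continuous_phaseSum hc1 hCu)
  have hexp : ∀ u, Complex.exp (Complex.I * f u) = 1 := fun u => by
    obtain ⟨ρ, hρ, h1⟩ := (hDCu u).det_eq
    obtain ⟨σ, hσ, h2⟩ := (hCu u).det_eq
    rw [Matrix.det_mul, Matrix.det_mul, h2, det_phaseDiag] at h1
    have hE : Complex.exp (Complex.I * phaseSum (phaseDiag θ * Cu u * phaseDiag θ)) =
        Complex.exp (Complex.I * f u) * (Complex.exp (Complex.I * ((∑ i, θ i : ℝ) : ℂ)) *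
          Complex.exp (Complex.I * phaseSum (Cu u)) *
          Complex.exp (Complex.I * ((∑ i, θ i : ℝ) : ℂ))) := by
      rw [← Complex.exp_add, ← Complex.exp_add, ← Complex.exp_add]
      congr 1
      simp only [f]
      push_cast
      ring
    set W := Complex.exp (Complex.I * ((∑ i, θ i : ℝ) : ℂ)) *
          Complex.exp (Complex.I * phaseSum (Cu u)) *
          Complex.exp (Complex.I * ((∑ i, θ i : ℝ) : ℂ)) with hW
    have hW0 : W ≠ 0 := by simp [hW, Complex.exp_ne_zero]
    have h3 : (σ : ℂ) * W = (ρ * Complex.exp (Complex.I * f u)) * W := by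
      rw [mul_assoc, ← hE, ← h1, hW]; ring
    have h4 := mul_right_cancel₀ hW0 h3
    have hn := congrArg norm h4
    rw [norm_mul, Complex.norm_exp_I_mul_ofReal, mul_one, Complex.norm_real, Complex.norm_real,
      norm_of_nonneg hσ.le, norm_of_nonneg hρ.le] at hn
    rw [hn] at h4
    have hρ' : (ρ : ℂ) ≠ 0 := by exact_mod_cast hρ.ne'
    exact mul_left_cancel₀ hρ' (by rw [← h4, mul_one])
  have h01 := eq_of_continuous_of_exp_eq_one hf hexp (π / 2) 0
  have e0 : f 0 = 0 := by
    simp only [f]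
    rw [hDCD]
    simp only [Cu, cos_zero, sin_zero, one_pow, one_smul, zero_pow two_ne_zero, zero_smul,
      add_zero]
    rw [phaseSum_phaseDiag hθ, phaseSum_phaseDiag hθ']
    simp
    ring
  have e1 : f (π / 2) = phaseSum (phaseDiag θ * C * phaseDiag θ) - 2 * ∑ i, θ i - phaseSum C := by
    simp [f, Cu]
  linarith

end PhaseSum

/-! ### Interlacing of phases and the majorization inequality. -/

section Interlacing

open Real

theorem IsAccretive.exists_antitone_phaseDiag {k : ℕ} {M : Matrix (Fin k) (Fin k) ℂ}
    (hM : IsAccretive M) :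
    ∃ (S : Matrix (Fin k) (Fin k) ℂ) (ψ : Fin k → ℝ), IsUnit S ∧ Antitone ψ ∧
      (∀ i, ψ i ∈ Set.Ioo (-(π / 2)) (π / 2)) ∧ M = Sᴴ * phaseDiag ψ * S := by
  obtain ⟨T, θ, hT, hθ, h⟩ := hM.exists_phaseDiag
  let σ := Tuple.sort (-θ)
  have hd : phaseDiag (θ ∘ σ) = (phaseDiag θ).submatrix σ σ := by
    rw [phaseDiag, phaseDiag, Matrix.submatrix_diagonal_equiv]
    rfl
  refine ⟨T.submatrix σ id, θ ∘ σ, ?_, fun i j hij => ?_, fun i => hθ _, ?_⟩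
  · exact (Matrix.isUnit_submatrix_equiv σ (Equiv.refl _)).2 hT
  · have := Tuple.monotone_sort (-θ) hij
    simpa using this
  · rw [hd, Matrix.conjTranspose_submatrix, Matrix.submatrix_mul_equiv,
      Matrix.submatrix_mul_equiv, Matrix.submatrix_id_id, h]

/-- Rotating by `-c` lets the sign of the imaginary part detect whether phases lie above or below
`c`, replacing the eigenvalue comparison of the Hermitian minimax argument. -/
theorem im_exp_mul_quadratic {I J : Type*} [Fintype I] [DecidableEq I] [Fintype J] (c : ℝ)
    (φ : I → ℝ) (T : Matrix I J ℂ) (v : J → ℂ) :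
    (Complex.exp (Complex.I * ((-c : ℝ) : ℂ)) *
      (star v ⬝ᵥ ((Tᴴ * phaseDiag φ * T) *ᵥ v))).im =
      ∑ i, sin (φ i - c) * Complex.normSq ((T *ᵥ v) i) := by
  rw [IsAccretive.star_dotProduct_congr, dotProduct, Finset.mul_sum, Complex.im_sum]
  refine Finset.sum_congr rfl fun i _ => ?_
  rw [phaseDiag, Matrix.mulVec_diagonal, Pi.star_apply, RCLike.star_def,
    mul_left_comm (conj _), ← Complex.normSq_eq_conj_mul_self, ← mul_assoc, ← Complex.exp_add,
    ← mul_add, ← Complex.ofReal_add, Complex.im_mul_ofReal, mul_comm Complex.I,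
    Complex.exp_ofReal_mul_I_im, neg_add_eq_sub]

/-- There is one linear condition for each index other than `i`, so `k - 1` conditions on a
`k`-dimensional space. -/
theorem exists_ne_zero_of_interlacing {N k : ℕ} (hk : k ≤ N) (T : Matrix (Fin N) (Fin k) ℂ)
    (S : Matrix (Fin k) (Fin k) ℂ) (i : Fin k) :
    ∃ v : Fin k → ℂ, v ≠ 0 ∧ (∀ j < i, (T *ᵥ v) (Fin.castLE hk j) = 0) ∧
      ∀ j > i, (S *ᵥ v) j = 0 := by
  let f : (Fin k → ℂ) →ₗ[ℂ] ({j : Fin k // j ≠ i} → ℂ) := LinearMap.pi fun j =>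
    if j.1 < i then LinearMap.proj (Fin.castLE hk j.1) ∘ₗ T.mulVecLin
    else LinearMap.proj j.1 ∘ₗ S.mulVecLin
  have hlt : Module.finrank ℂ ({j : Fin k // j ≠ i} → ℂ) < Module.finrank ℂ (Fin k → ℂ) := by
    rw [Module.finrank_fintype_fun_eq_card, Module.finrank_fintype_fun_eq_card]
    exact Fintype.card_subtype_lt (x := i) (by simp)
  obtain ⟨v, hv, hv0⟩ :=
    (Submodule.ne_bot_iff _).1 (LinearMap.ker_ne_bot_of_finrank_lt hlt (f := f))
  refine ⟨v, hv0, fun j hj => ?_, fun j hj => ?_⟩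
  · have := congrFun (LinearMap.mem_ker.1 hv) ⟨j, hj.ne⟩
    simpa [f, hj] using this
  · have := congrFun (LinearMap.mem_ker.1 hv) ⟨j, hj.ne'⟩
    simpa [f, hj.not_gt] using this

/-- Interlacing: the sum of the phases of a compression to `k` dimensions is at most the sum of
the `k` largest phases. -/
theorem phaseSum_compression_le {N k : ℕ} (hk : k ≤ N) {φ : Fin N → ℝ} (hφ : Antitone φ)
    (hφr : ∀ i, φ i ∈ Set.Ioo (-(π / 2)) (π / 2)) {T : Matrix (Fin N) (Fin k) ℂ}
    (hT : ∀ v, T *ᵥ v = 0 → v = 0) :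
    phaseSum (Tᴴ * phaseDiag φ * T) ≤ ∑ i : Fin k, φ (Fin.castLE hk i) := by
  obtain ⟨S, ψ, hS, hψ, hψr, h⟩ :=
    ((isAccretive_phaseDiag hφr).congr hT).exists_antitone_phaseDiag
  rw [h, phaseSum_eq hψr hS]
  refine Finset.sum_le_sum fun i _ => ?_
  by_contra! hlt
  obtain ⟨v, hv, h1, h2⟩ := exists_ne_zero_of_interlacing hk T S i
  -- The same number is computed in two ways. In the coordinates of `S` only phases at least `ψ i`
  -- contribute; in those of `T` only phases at most `φ i`, which is assumed smaller than `ψ i`.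
  have e1 := im_exp_mul_quadratic (ψ i) φ T v
  rw [h, im_exp_mul_quadratic] at e1
  have hpos : 0 ≤ ∑ j, sin (ψ j - ψ i) * Complex.normSq ((S *ᵥ v) j) := by
    refine Finset.sum_nonneg fun j _ => ?_
    rcases lt_or_ge i j with hij | hij
    · rw [h2 j hij]; simp
    · refine mul_nonneg (sin_nonneg_of_nonneg_of_le_pi (sub_nonneg.2 (hψ hij)) ?_)
        (Complex.normSq_nonneg _)
      linarith [(hψr j).2, (hψr i).1]
  have hneg : ∑ j, sin (φ j - ψ i) * Complex.normSq ((T *ᵥ v) j) < 0 := by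
    have hterm : ∀ j, (T *ᵥ v) j ≠ 0 → sin (φ j - ψ i) < 0 := fun j hj => by
      have hij : Fin.castLE hk i ≤ j := by
        by_contra! hji
        exact hj (h1 ⟨j, lt_trans (Fin.lt_def.1 hji) i.2⟩ hji)
      refine sin_neg_of_neg_of_neg_pi_lt ?_ ?_
      · linarith [hφ hij]
      · linarith [(hφr j).1, (hψr i).2]
    obtain ⟨j, hj⟩ := Function.ne_iff.1 fun h0 => hv (hT v h0)
    refine Finset.sum_neg' (fun j _ => ?_) ⟨j, Finset.mem_univ _,
      mul_neg_of_neg_of_pos (hterm j hj) (Complex.normSq_pos.2 hj)⟩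
    by_cases hj : (T *ᵥ v) j = 0
    · simp [hj]
    · exact mul_nonpos_of_nonpos_of_nonneg (hterm j hj).le (Complex.normSq_nonneg _)
  linarith

/-- The phases of the solution `G` of `G A⁻¹ G = B` are majorized by the mean of the phases of
`A` and `B`, when `G` is a diagonal unitary matrix. -/
theorem two_mul_sum_le_of_riccati {N k : ℕ} {α β θ : Fin N → ℝ}
    (hα : Antitone α) (hβ : Antitone β)
    (hαr : ∀ i, α i ∈ Set.Ioo (-(π / 2)) (π / 2)) (hβr : ∀ i, β i ∈ Set.Ioo (-(π / 2)) (π / 2))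
    (hθr : ∀ i, θ i ∈ Set.Ioo (-(π / 2)) (π / 2)) {S R : Matrix (Fin N) (Fin N) ℂ}
    (hS : IsUnit S) (hR : IsUnit R)
    (h : phaseDiag θ * (Sᴴ * phaseDiag α * S)⁻¹ * phaseDiag θ = Rᴴ * phaseDiag β * R)
    (hk : k ≤ N) {f : Fin k → Fin N} (hf : Function.Injective f) :
    2 * ∑ i, θ (f i) ≤ ∑ i, (α (Fin.castLE hk i) + β (Fin.castLE hk i)) := by
  obtain ⟨A, hA⟩ : ∃ A, A = Sᴴ * phaseDiag α * S := ⟨_, rfl⟩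
  have hAacc : IsAccretive A := hA ▸ (isAccretive_phaseDiag hαr).congr_unit hS
  -- Compression by `V` selects a principal submatrix; a coordinate compression is needed so that
  -- the diagonal factors can be pulled out in `hD`.
  let V : Matrix (Fin N) (Fin k) ℂ := (1 : Matrix (Fin N) (Fin N) ℂ).submatrix id f
  have hVinj : ∀ v, V *ᵥ v = 0 → v = 0 := fun v hv => by
    ext i
    have := congrFun hv (f i)
    simpa [V, Matrix.mulVec, dotProduct, Matrix.one_apply, hf.eq_iff] using this
  have hV : ∀ M : Matrix (Fin N) (Fin N) ℂ, Vᴴ * M * V = M.submatrix f f := fun M => by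
    have : Vᴴ = (1 : Matrix (Fin N) (Fin N) ℂ).submatrix f id := by
      simp [V, Matrix.conjTranspose_submatrix]
    rw [this]
    ext i j
    simp [V, Matrix.mul_apply, Matrix.one_apply]
  have hinj : ∀ W : Matrix (Fin N) (Fin N) ℂ, IsUnit W → ∀ v, (W * V) *ᵥ v = 0 → v = 0 :=
    fun W hW v hv => hVinj v (IsAccretive.mulVec_injective_of_isUnit hW _
      (by rw [Matrix.mulVec_mulVec, hv]))
  have hcomp : ∀ W M : Matrix (Fin N) (Fin N) ℂ,
      (W * V)ᴴ * M * (W * V) = Vᴴ * (Wᴴ * M * W) * V := fun W M => by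
    simp only [Matrix.conjTranspose_mul, Matrix.mul_assoc]
  have hB1 := phaseSum_compression_le hk hβ hβr (hinj R hR)
  rw [hcomp, ← h, ← hA] at hB1
  have hAi : IsUnit A⁻¹ := Matrix.isUnit_nonsing_inv_iff.2 hAacc.isUnit
  have hA1 := phaseSum_compression_le hk hα hαr (hinj (S * A⁻¹) (hS.mul hAi))
  have hC : IsAccretive (Vᴴ * A⁻¹ * V) := hAacc.inv.congr hVinj
  -- The phases of `(A⁻¹)ᴴ` are those of `A`, so interlacing for it bounds minus the phase sum of
  -- the compressed `A⁻¹` from above.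
  have e : (S * A⁻¹)ᴴ * phaseDiag α * (S * A⁻¹) = (A⁻¹)ᴴ := by
    rw [hAacc.conjTranspose_inv_eq_congr, Matrix.conjTranspose_mul]
    calc _ = (A⁻¹)ᴴ * (Sᴴ * phaseDiag α * S) * A⁻¹ := by simp only [Matrix.mul_assoc]
      _ = _ := by rw [← hA]
  have e2 : Vᴴ * (A⁻¹)ᴴ * V = (Vᴴ * A⁻¹ * V)ᴴ := by
    simp only [Matrix.conjTranspose_mul, Matrix.conjTranspose_conjTranspose, Matrix.mul_assoc]
  rw [hcomp, e, e2, phaseSum_conjTranspose _ hC] at hA1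
  have hD : Vᴴ * (phaseDiag θ * A⁻¹ * phaseDiag θ) * V =
      phaseDiag (θ ∘ f) * (Vᴴ * A⁻¹ * V) * phaseDiag (θ ∘ f) := by
    rw [hV, hV]
    ext i j
    simp [phaseDiag, Matrix.diagonal_mul, Matrix.mul_diagonal]
  have hBacc : IsAccretive (Vᴴ * (phaseDiag θ * A⁻¹ * phaseDiag θ) * V) := by
    rw [hA, h]
    exact ((isAccretive_phaseDiag hβr).congr_unit hR).congr hVinj
  rw [hD] at hBacc hB1
  rw [phaseSum_phaseDiag_mul_mul (θ := θ ∘ f) (fun i => hθr (f i)) hC hBacc] at hB1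
  rw [Finset.sum_add_distrib]
  simp only [Function.comp_apply] at hB1
  linarith

/-- Without compression, congruence invariance gives the exact phase sums in place of the
interlacing bounds. -/
theorem two_mul_sum_eq_of_riccati {N : ℕ} {α β θ : Fin N → ℝ}
    (hαr : ∀ i, α i ∈ Set.Ioo (-(π / 2)) (π / 2)) (hβr : ∀ i, β i ∈ Set.Ioo (-(π / 2)) (π / 2))
    (hθr : ∀ i, θ i ∈ Set.Ioo (-(π / 2)) (π / 2)) {S R : Matrix (Fin N) (Fin N) ℂ}
    (hS : IsUnit S) (hR : IsUnit R)
    (h : phaseDiag θ * (Sᴴ * phaseDiag α * S)⁻¹ * phaseDiag θ = Rᴴ * phaseDiag β * R) :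
    2 * ∑ i, θ i = ∑ i, (α i + β i) := by
  obtain ⟨A, hA⟩ : ∃ A, A = Sᴴ * phaseDiag α * S := ⟨_, rfl⟩
  have hAacc : IsAccretive A := hA ▸ (isAccretive_phaseDiag hαr).congr_unit hS
  have hB : IsAccretive (Rᴴ * phaseDiag β * R) := (isAccretive_phaseDiag hβr).congr_unit hR
  have hC : phaseSum A⁻¹ = -∑ i, α i := by
    have hAi : IsUnit A⁻¹ := Matrix.isUnit_nonsing_inv_iff.2 hAacc.isUnit
    have e := phaseSum_congr A hAi
    rw [← hAacc.conjTranspose_inv_eq_congr, phaseSum_conjTranspose _ hAacc.inv] at e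
    nth_rewrite 2 [hA] at e
    rw [phaseSum_eq hαr hS] at e
    linarith
  rw [← hA] at h
  have := phaseSum_phaseDiag_mul_mul hθr hAacc.inv (by rw [h]; exact hB)
  rw [h, phaseSum_eq hβr hR, hC] at this
  rw [Finset.sum_add_distrib]
  linarith

end Interlacing

/-! ### Majorization and symmetric gauge functions. -/

section Majorization

/-- Abel summation: an antitone weight against a sequence with nonnegative partial sums. -/
theorem antitone_mul_sum_le {n : ℕ} {w d : Fin (n + 1) → ℝ} (hw : Antitone w)
    (hd : ∀ k, ∀ hk : k ≤ n + 1, 0 ≤ ∑ i : Fin k, d (Fin.castLE hk i)) :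
    w (Fin.last n) * ∑ i, d i ≤ ∑ i, w i * d i := by
  induction n with
  | zero => simp
  | succ n ih =>
    have h1 := ih (w := fun i => w i.castSucc) (d := fun i => d i.castSucc)
      (fun i j hij => hw (Fin.castSucc_le_castSucc_iff.2 hij))
      (fun k hk => hd k (hk.trans (Nat.le_succ _)))
    have h0 : 0 ≤ ∑ i : Fin (n + 1), d i.castSucc := hd (n + 1) (Nat.le_succ _)
    have h2 : w (Fin.last (n + 1)) ≤ w (Fin.last n).castSucc := hw (Fin.le_last _)
    rw [Fin.sum_univ_castSucc, Fin.sum_univ_castSucc (f := fun i => w i * d i), mul_add]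
    linarith [mul_le_mul_of_nonneg_right h2 h0]

theorem sum_antitone_mul_nonneg {N : ℕ} {w d : Fin N → ℝ} (hw : Antitone w)
    (hd : ∀ k, ∀ hk : k ≤ N, 0 ≤ ∑ i : Fin k, d (Fin.castLE hk i)) (h0 : ∑ i, d i = 0) :
    0 ≤ ∑ i, w i * d i := by
  cases N with
  | zero => simp
  | succ n => simpa [h0] using antitone_mul_sum_le hw hd

/-- Rado's theorem: a vector majorized by `γ` lies in the convex hull of the permutations of
`γ`. -/
theorem mem_convexHull_of_majorized {N : ℕ} {θ γ : Fin N → ℝ}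
    (h : ∀ k, ∀ hk : k ≤ N, ∀ f : Fin k → Fin N, Function.Injective f →
      ∑ i, θ (f i) ≤ ∑ i, γ (Fin.castLE hk i)) (h0 : ∑ i, θ i = ∑ i, γ i) :
    θ ∈ convexHull ℝ (Set.range fun σ : Equiv.Perm (Fin N) => γ ∘ σ) := by
  by_contra hθ
  obtain ⟨F, u, hu, huθ⟩ := geometric_hahn_banach_closed_point (convex_convexHull ℝ _)
    ((Set.finite_range fun σ : Equiv.Perm (Fin N) => γ ∘ σ).isCompact_convexHull ℝ).isClosed hθ
  let c : Fin N → ℝ := fun i => F (Pi.single i 1)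
  have hF : ∀ x, F x = ∑ i, c i * x i := fun x => by
    conv_lhs => rw [← Finset.univ_sum_single x]
    rw [map_sum]
    refine Finset.sum_congr rfl fun i _ => ?_
    rw [mul_comm, ← smul_eq_mul, ← map_smul, ← Pi.single_smul, smul_eq_mul, mul_one]
  -- Sorting the coefficients of the separating functional decreasingly pairs them with the partial
  -- sums of `γ`. The permutation `γ ∘ τ.symm` then has functional value at least that of `θ`,
  -- contradicting separation.
  let τ := Tuple.sort (-c)
  have hτ : Antitone (c ∘ τ) := fun i j hij => by
    have := Tuple.monotone_sort (-c) hij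
    simpa using this
  have hn := sum_antitone_mul_nonneg (d := fun i => γ i - θ (τ i)) hτ
    (fun k hk => by
      rw [Finset.sum_sub_distrib, sub_nonneg]
      exact h k hk (fun i => τ (Fin.castLE hk i))
        (τ.injective.comp (Fin.castLE_injective hk)))
    (by rw [Finset.sum_sub_distrib, Equiv.sum_comp τ θ, h0, sub_self])
  have h1 := hu (γ ∘ τ.symm) (subset_convexHull ℝ _ ⟨τ.symm, rfl⟩)
  rw [hF, ← Equiv.sum_comp τ] at h1 huθ
  simp only [Function.comp_apply, Equiv.symm_apply_apply, mul_sub, Finset.sum_sub_distrib]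
    at h1 hn
  linarith

/-- The sublevel set of `Ψ` at `Ψ γ` is convex and contains every permutation of `γ`. -/
theorem IsSymmetricGauge.le_of_mem_convexHull {ι : Type*} {Ψ : (ι → ℝ) → ℝ}
    (hΨ : IsSymmetricGauge Ψ) {θ γ : ι → ℝ}
    (h : θ ∈ convexHull ℝ (Set.range fun σ : Equiv.Perm ι => γ ∘ σ)) : Ψ θ ≤ Ψ γ := by
  have hconv : Convex ℝ {x | Ψ x ≤ Ψ γ} := by
    intro x hx y hy a b ha hb hab
    calc Ψ (a • x + b • y) ≤ Ψ (a • x) + Ψ (b • y) := hΨ.add_le _ _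
      _ = a * Ψ x + b * Ψ y := by rw [hΨ.smul, hΨ.smul, abs_of_nonneg ha, abs_of_nonneg hb]
      _ ≤ a * Ψ γ + b * Ψ γ :=
        add_le_add (mul_le_mul_of_nonneg_left hx ha) (mul_le_mul_of_nonneg_left hy hb)
      _ = Ψ γ := by rw [← add_mul, hab, one_mul]
  refine convexHull_min ?_ hconv h
  rintro _ ⟨σ, rfl⟩
  exact (hΨ.perm σ γ).le

end Majorization

/-! ### The gauge inequality for canonical phase vectors. -/

namespace Tensor3

open Real

variable {n p : ℕ}

theorem isPhaseVector_tPhase {A : Tensor3 n n p} (hA : A ∈ TPlus n p) :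
    IsPhaseVector A (tPhase A) := by
  have h := (existsUnique_isPhaseVector hA).exists
  rw [tPhase, dif_pos h]
  exact h.choose_spec

/-- The canonical phase vector, after identification of the index type with `Fin (n * p)`. -/
theorem exists_phaseDiag_tPhase {A : Tensor3 n n p} (hA : A ∈ TPlus n p)
    (e₀ : Fin p × Fin n ≃ Fin (n * p)) :
    Antitone (tPhase A) ∧ (∀ k, tPhase A k ∈ Set.Ioo (-(π / 2)) (π / 2)) ∧
      ∃ T : Matrix (Fin (n * p)) (Fin (n * p)) ℂ, IsUnit T ∧
        (bcirc A).submatrix e₀.symm e₀.symm = Tᴴ * phaseDiag (tPhase A) * T := by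
  obtain ⟨hanti, hr, -, T, e, hT, h⟩ := isPhaseVector_tPhase hA
  have hlt := phase_lt (θ := fun x => tPhase A (e x)) (bcirc_pos hA) hT (fun x => hr _) h
  refine ⟨hanti, fun k => by simpa using hlt (e.symm k), T.submatrix e.symm e₀.symm, ?_, ?_⟩
  · exact (Matrix.isUnit_submatrix_equiv e.symm e₀.symm).2 hT
  · have hd : phaseDiag (tPhase A) =
        (Matrix.diagonal fun x => Complex.exp (Complex.I * tPhase A (e x))).submatrix
          e.symm e.symm := by
      rw [Matrix.submatrix_diagonal_equiv, phaseDiag]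
      congr 1
      ext k
      simp
    rw [hd, Matrix.conjTranspose_submatrix, Matrix.submatrix_mul_equiv,
      Matrix.submatrix_mul_equiv, h]

theorem phaseGauge_geomMean_le [NeZero p] {A B : Tensor3 n n p} (hA : A ∈ TPlus n p)
    (hB : B ∈ TPlus n p) {Ψ : (Fin (n * p) → ℝ) → ℝ} (hΨ : IsSymmetricGauge Ψ) :
    phaseGauge Ψ (geomMean A B) ≤ (1 / 2) * phaseGauge Ψ A + (1 / 2) * phaseGauge Ψ B := by
  let e₀ : Fin p × Fin n ≃ Fin (n * p) :=
    finProdFinEquiv.trans (finCongr (Nat.mul_comm p n))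
  obtain ⟨hα, hαr, S, hS, hAS⟩ := exists_phaseDiag_tPhase hA e₀
  obtain ⟨hβ, hβr, R, hR, hBR⟩ := exists_phaseDiag_tPhase hB e₀
  obtain ⟨-, hθr, T, hT, hGT⟩ := exists_phaseDiag_tPhase (geomMean_mem_TPlus hA hB) e₀
  have hric := congrArg (fun M => M.submatrix e₀.symm e₀.symm) (bcirc_geomMean_riccati hA hB)
  simp only [← Matrix.submatrix_mul_equiv _ _ _ e₀.symm, ← Matrix.inv_submatrix_equiv] at hric
  rw [hAS, hBR, hGT] at hric
  simp only [phaseGauge]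
  generalize tPhase A = α at *
  generalize tPhase B = β at *
  generalize tPhase (geomMean A B) = θ at *
  have hdet : IsUnit T.det := (Matrix.isUnit_iff_isUnit_det T).1 hT
  have hdet' : IsUnit Tᴴ.det := by rw [Matrix.det_conjTranspose]; exact hdet.star
  have hTi : IsUnit T⁻¹ := Matrix.isUnit_nonsing_inv_iff.2 hT
  have hl : (T⁻¹)ᴴ * Tᴴ = 1 := by
    rw [← Matrix.conjTranspose_mul, Matrix.mul_nonsing_inv _ hdet, Matrix.conjTranspose_one]
  have hr := Matrix.mul_nonsing_inv _ hdet
  have hTT : (T⁻¹)ᴴ = Tᴴ⁻¹ := Matrix.conjTranspose_nonsing_inv T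
  -- The Riccati equation is preserved when all three matrices undergo the same congruence. The one
  -- by `T⁻¹` makes the mean equal to `phaseDiag θ` and keeps the phases of `A` and `B`.
  have hric' : phaseDiag θ * ((S * T⁻¹)ᴴ * phaseDiag α * (S * T⁻¹))⁻¹ * phaseDiag θ =
      (R * T⁻¹)ᴴ * phaseDiag β * (R * T⁻¹) := by
    have e1 : ((S * T⁻¹)ᴴ * phaseDiag α * (S * T⁻¹))⁻¹ =
        T * (Sᴴ * phaseDiag α * S)⁻¹ * Tᴴ := by
      have : (S * T⁻¹)ᴴ * phaseDiag α * (S * T⁻¹) = Tᴴ⁻¹ * (Sᴴ * phaseDiag α * S) * T⁻¹ := by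
        rw [← hTT]; simp only [Matrix.conjTranspose_mul, Matrix.mul_assoc]
      rw [this, Matrix.mul_inv_rev, Matrix.mul_inv_rev, Matrix.nonsing_inv_nonsing_inv _ hdet,
        Matrix.nonsing_inv_nonsing_inv _ hdet', ← Matrix.mul_assoc T]
    have e2 : (R * T⁻¹)ᴴ * phaseDiag β * (R * T⁻¹) =
        (T⁻¹)ᴴ * (Rᴴ * phaseDiag β * R) * T⁻¹ := by
      simp only [Matrix.conjTranspose_mul, Matrix.mul_assoc]
    rw [e1, e2, ← hric]
    calc _ = ((T⁻¹)ᴴ * Tᴴ) * (phaseDiag θ * (T * (Sᴴ * phaseDiag α * S)⁻¹ * Tᴴ) * phaseDiag θ) *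
          (T * T⁻¹) := by rw [hl, hr, Matrix.one_mul, Matrix.mul_one]
      _ = _ := by simp only [Matrix.mul_assoc]
  have hmem : θ ∈ convexHull ℝ
      (Set.range fun σ : Equiv.Perm (Fin (n * p)) => ((1 / 2 : ℝ) • α + (1 / 2 : ℝ) • β) ∘ σ) := by
    refine mem_convexHull_of_majorized (fun k hk f hf => ?_) ?_
    · have := two_mul_sum_le_of_riccati hα hβ hαr hβr hθr (hS.mul hTi) (hR.mul hTi) hric' hk hf
      simp only [Pi.add_apply, Pi.smul_apply, smul_eq_mul, ← mul_add, ← Finset.mul_sum]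
      linarith
    · have := two_mul_sum_eq_of_riccati hαr hβr hθr (hS.mul hTi) (hR.mul hTi) hric'
      simp only [Pi.add_apply, Pi.smul_apply, smul_eq_mul, ← mul_add, ← Finset.mul_sum]
      linarith
  calc Ψ θ ≤ Ψ ((1 / 2 : ℝ) • α + (1 / 2 : ℝ) • β) := hΨ.le_of_mem_convexHull hmem
    _ ≤ Ψ ((1 / 2 : ℝ) • α) + Ψ ((1 / 2 : ℝ) • β) := hΨ.add_le _ _
    _ = _ := by rw [hΨ.smul, hΨ.smul, abs_of_pos (by norm_num : (0 : ℝ) < 1 / 2)]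

end Tensor3

theorem mainTheorem6 (n p : ℕ) [NeZero p] (A B : Tensor3 n n p)
    (hA : A ∈ Tensor3.TPlus n p) (hB : B ∈ Tensor3.TPlus n p)
    (Ψ : (Fin (n * p) → ℝ) → ℝ) (hΨ : IsSymmetricGauge Ψ) :
    (∀ t : ℝ, 0 < t →
        Tensor3.IsTInverse (t • A + t⁻¹ • B) (Tensor3.tInv (t • A + t⁻¹ • B))) ∧
      MeasureTheory.IntegrableOn (Tensor3.geomMeanIntegrand A B) (Set.Ioi 0) ∧
      Tensor3.IsTInverse (Tensor3.geomMean A B) (Tensor3.geomMeanIntegral A B) ∧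
      Tensor3.geomMean A B ∈ Tensor3.TPlus n p ∧
      Tensor3.phaseGauge Ψ (Tensor3.geomMean A B) ≤
        (1 / 2) * Tensor3.phaseGauge Ψ A + (1 / 2) * Tensor3.phaseGauge Ψ B :=
  ⟨fun t ht => Tensor3.isTInverse_tInv (Tensor3.isAccretive_bcirc_smul_add hA hB ht.le
      (inv_nonneg.2 ht.le) (by positivity)).isUnit,
    Tensor3.integrableOn_geomMeanIntegrand hA hB, Tensor3.isTInverse_geomMean hA hB,
    Tensor3.geomMean_mem_TPlus hA hB, Tensor3.phaseGauge_geomMean_le hA hB hΨ⟩
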